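/- Let $\xi$ be a real random variable with cumulant-generating function $\Lambda(t)=\ln\mathbb{E}e^{t\xi}$. Suppose that $\xi$ is subgaussian, i.e. there is a constant $C$ with $\Lambda(t)\le Ct^2$ for all $t\in\mathbb{R}$ (in particular $\Lambda$ is finite everywhere). Let $\Lambda^*(s)=\sup_{t\in\mathbb{R}}\{st-\Lambda(t)\}\in[0,\infty]$ be its Legendre transform. Regard $s\mapsto\Lambda^*(s)/s^2$ as a function $\mathbb{R}\to[0,\infty]$ whose value at $s=0$ is $\lim_{u\to0}\Lambda^*(u)/u^2$. For each $n$ let $A_n$ be a random symmetric $n\times n$ matrix with zero diagonal whose entries above the diagonal are i.i.d. with the law of $\xi$. Write $\lambda_1(A_n)\ge\lambda_2(A_n)\ge\cdots$ for its eigenvalues and $\sigma_1(A_n)\ge\sigma_2(A_n)\ge\cdots$ for its singular values. Let $k\ge1$ be an integer and let $(m_n)$ be a sequence of real numbers with $m_n/\sqrt n\to\infty$ and $m_n/n\to0$. Define $I:\mathbb{R}^k\to[0,\infty]$ by $$I(x)=\frac{|x|^2}{2}\,\inf_{s\in\mathbb{R}}\frac{\Lambda^*(s)}{s^2}\quad\text{if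 } x_1\ge x_2\ge\cdots\ge x_k\ge0,\qquad I(x)=+\infty\ \text{ otherwise},$$ where $|x|$ is the Euclidean norm and $0\cdot\infty=0$. Random vectors $X_n$ in $\mathbb{R}^k$ are said to satisfy a large deviation principle (LDP) with speed $m_n^2$ and good rate function $I$ if $I\ge 0$ has compact sublevel sets $\{I\le c\}$, $c\in\mathbb{R}$, and $$\limsup_{n\to\infty}\frac1{m_n^2}\ln\Pr(X_n\in F)\le-\inf_{x\in F}I(x),\qquad \liminf_{n\to\infty}\frac1{m_n^2}\ln\Pr(X_n\in G)\ge-\inf_{x\in G}I(x)$$ for every closed $F\subset\mathbb{R}^k$ and every open $G\subset\mathbb{R}^k$. **Theorem.** The sequence $\frac1{m_n}(\sigma_1(A_n),\dots,\sigma_k(A_n))$ (defined for $n\ge k$) satisfies an LDP in $\mathbb{R}^k$ with speed $m_n^2$ and good rate function $I$. If, in addition, the function $s\mapsto\Lambda^*(s)/s^2$ attains its infimum over $\mathbb{R}$ at some $s\ge0$, then $\frac1{m_n}(\lambda_1(A_n),\dots,\lambda_k(A_n))$ satisfies an LDP in $\mathbb{R}^k$ with speed $m_n^2$ and the same good rate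 function $I$. -/

import Mathlib

open MeasureTheory ProbabilityTheory Filter Topology

/-- `ξ` is subgaussian: its cumulant generating function `Λ` is finite everywhere and
`Λ t ≤ C t ^ 2` for some constant `C` and all real `t`. -/
def IsSubgaussian {Ω : Type*} [MeasurableSpace Ω] (ξ : Ω → ℝ) (μ : Measure Ω) : Prop :=
  ∃ C : ℝ, ∀ t : ℝ, Integrable (fun ω => Real.exp (t * ξ ω)) μ ∧ cgf ξ μ t ≤ C * t ^ 2

/-- The Legendre transform `f^*(y) = sup_x (x y - f x)`, with values in the extended reals. -/
noncomputable def legendre (f : ℝ → ℝ) (y : ℝ) : EReal :=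
  ⨆ x : ℝ, ((x * y - f x : ℝ) : EReal)

/-- The function `s ↦ f^*(s) / s ^ 2`, extended to `s = 0` by its limit there.
(The lower limit is used so that the value is always defined; for the cumulant generating
function of a subgaussian variable the limit exists in `(0, ∞]`.) -/
noncomputable def legendreRatio (f : ℝ → ℝ) (s : ℝ) : EReal :=
  if s = 0 then liminf (fun u : ℝ => legendre f u / ((u ^ 2 : ℝ) : EReal)) (𝓝[≠] 0)
  else legendre f s / ((s ^ 2 : ℝ) : EReal)

/-- A good rate function: nonnegative, with compact sublevel sets
(on a Hausdorff space this includes lower semicontinuity). -/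
def IsGoodRateFunction {E : Type*} [TopologicalSpace E] (I : E → EReal) : Prop :=
  (∀ x, 0 ≤ I x) ∧ ∀ c : ℝ, IsCompact {x | I x ≤ (c : EReal)}

/-- The random elements `X n` of `E` (each on its own probability space) satisfy a large
deviation principle with speed `a n` and good rate function `I`. -/
structure SatisfiesLDP {E : Type*} [TopologicalSpace E] {Ω : ℕ → Type*}
    [∀ n, MeasurableSpace (Ω n)] (P : ∀ n, Measure (Ω n)) (X : ∀ n, Ω n → E)
    (a : ℕ → ℝ) (I : E → EReal) : Prop where
  good : IsGoodRateFunction I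
  upper : ∀ F : Set E, IsClosed F →
    limsup (fun n => (((a n)⁻¹ : ℝ) : EReal) * ENNReal.log (P n {ω | X n ω ∈ F})) atTop
      ≤ -⨅ x ∈ F, I x
  lower : ∀ G : Set E, IsOpen G →
    -⨅ x ∈ G, I x
      ≤ liminf (fun n => (((a n)⁻¹ : ℝ) : EReal) * ENNReal.log (P n {ω | X n ω ∈ G})) atTop

/-- `A` is a random symmetric matrix with zero diagonal whose entries above the diagonal are
independent and distributed as `ξ`. (Over the reals, Hermitian means symmetric.) -/
structure IsSymmIIDMatrix {Ω Ω' : Type*} [MeasurableSpace Ω] [MeasurableSpace Ω'] {n : ℕ}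
    (A : Ω → Matrix (Fin n) (Fin n) ℝ) (P : Measure Ω) (ξ : Ω' → ℝ) (μ : Measure Ω') : Prop where
  isHermitian : ∀ ω, (A ω).IsHermitian
  diag_eq_zero : ∀ ω i, A ω i i = 0
  iIndep : iIndepFun (fun (p : {p : Fin n × Fin n // p.1 < p.2}) ω => A ω p.1.1 p.1.2) P
  identDistrib : ∀ i j : Fin n, i < j → IdentDistrib (fun ω => A ω i j) ξ P μ

/-- The vector of the `k` largest singular values of a square matrix, in non-increasing order
(padded with zeros if the matrix has size less than `k`). -/
noncomputable def topSingularValues (k : ℕ) {n : ℕ} (M : Matrix (Fin n) (Fin n) ℝ) :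
    EuclideanSpace ℝ (Fin k) :=
  WithLp.toLp 2 fun i => (Matrix.toEuclideanLin M).singularValues (i : ℕ)

/-- The vector of the `k` largest eigenvalues of a symmetric matrix, in non-increasing order
(padded with zeros if the matrix has size less than `k`). -/
noncomputable def topEigenvalues (k : ℕ) {n : ℕ} {M : Matrix (Fin n) (Fin n) ℝ}
    (hM : M.IsHermitian) : EuclideanSpace ℝ (Fin k) :=
  WithLp.toLp 2 fun i =>
    if h : (i : ℕ) < Fintype.card (Fin n) then hM.eigenvalues₀ ⟨i, h⟩ else 0

/-- The closed cone of vectors `x` with `x_1 ≥ x_2 ≥ ⋯ ≥ x_k ≥ 0`. -/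
def orderedCone (k : ℕ) : Set (EuclideanSpace ℝ (Fin k)) :=
  {x | (∀ i j : Fin k, i ≤ j → x j ≤ x i) ∧ ∀ i, 0 ≤ x i}

open scoped Classical in
/-- The rate function `I x = |x| ^ 2 / 2 * inf_s f^*(s) / s ^ 2` on the cone of non-increasing
nonnegative vectors, and `+∞` elsewhere (`0 * ∞ = 0`). -/
noncomputable def ldpRate (f : ℝ → ℝ) (k : ℕ) (x : EuclideanSpace ℝ (Fin k)) : EReal :=
  if x ∈ orderedCone k then ((‖x‖ ^ 2 / 2 : ℝ) : EReal) * ⨅ s : ℝ, legendreRatio f s else ⊤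

/-! Write Λ for the cumulant-generating function and J for a lower bound of Λ*(s)/s². Everything
rests on two estimates that match to first order in m².

Upper bound. The Euclidean norm of the k leading singular values (or eigenvalues) of A is at most a
pairing ⟨A, B⟩ with some B of rank at most k and Hilbert–Schmidt norm at most 1
(`exists_rankSum_ge`). For fixed B this is a linear form in independent entries. Convex duality
turns Λ*(s) ≥ J s² into Λ(t) ≤ t²/(4J) (`le_of_le_legendreRatio`), and Chernoff's bound gives
probability at most exp(-J m² r²/2) that ⟨A, B⟩ ≥ m r. Such B have factorizations with 2kn real
parameters, so a net costs a factor exp(O(n)), which is negligible because m/√n → ∞. The net error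
is measured against the maximal pairing itself and only costs a factor close to 1
(`exists_net_pairing`).

Lower bound. Choose t with s = Λ'(t) ≠ 0. Tilt by t the entries in k disjoint diagonal blocks of
sizes about x_j m/|s|, which fit because m/n → 0. The tilted matrix has as centre a block matrix
with leading eigenvalues about s l_j, where the l_j are the block sizes. The noise has small
operator norm on the scale m by the same net argument with k = 1. Changing measure costs about (∑
l_j²)/2 times tΛ'(t) - Λ(t), which is m² (|x|²/2) (tΛ'(t) - Λ(t))/s² (`exists_block_event`,
`eventually_le_measure_near`). These quotients come arbitrarily close to the infimum of Λ*(s)/s²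
(`exists_deriv_ne_zero`).

Singular values do not see the sign of s. Eigenvalues need s > 0, and a minimizer at some s ≥ 0
provides it (`exists_deriv_pos_of_minimizer`). Leading eigenvalues might also be negative, but zero
trace keeps them above -o(m) while their norm is O(m), so they stay near the cone
(`topEigenvalues_ge_of_trace_eq_zero`). -/

set_option linter.unusedSectionVars false

/-! ### Courant–Fischer bounds for eigenvalues and singular values. -/

section Minimax

variable {E : Type*} [NormedAddCommGroup E] [InnerProductSpace ℝ E] [FiniteDimensional ℝ E]
  {n : ℕ}

theorem LinearMap.IsSymmetric.inner_apply_self_eq_sum {T : E →ₗ[ℝ] E} (hT : T.IsSymmetric)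
    (hn : Module.finrank ℝ E = n) (v : E) :
    inner ℝ (T v) v = ∑ j, hT.eigenvalues hn j * (inner ℝ (hT.eigenvectorBasis hn j) v) ^ 2 := by
  rw [← (hT.eigenvectorBasis hn).sum_inner_mul_inner (T v) v]
  refine Finset.sum_congr rfl fun j _ => ?_
  rw [hT v, hT.apply_eigenvectorBasis hn j, inner_smul_right, real_inner_comm]
  simp
  ring

theorem OrthonormalBasis.norm_sq_eq_sum_inner_sq {ι : Type*} [Fintype ι]
    (b : OrthonormalBasis ι ℝ E) (v : E) : ‖v‖ ^ 2 = ∑ j, (inner ℝ (b j) v) ^ 2 := by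
  rw [← real_inner_self_eq_norm_sq, ← b.sum_inner_mul_inner v v]
  refine Finset.sum_congr rfl fun j _ => ?_
  rw [real_inner_comm v, sq]

/-- Courant–Fischer, lower bound for an eigenvalue. -/
theorem LinearMap.IsSymmetric.le_eigenvalues_of_submodule {T : E →ₗ[ℝ] E} (hT : T.IsSymmetric)
    (hn : Module.finrank ℝ E = n) (i : Fin n) (V : Submodule ℝ E)
    (hV : (i : ℕ) < Module.finrank ℝ V) (c : ℝ)
    (h : ∀ v ∈ V, c * ‖v‖ ^ 2 ≤ inner ℝ (T v) v) : c ≤ hT.eigenvalues hn i := by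
  set b := hT.eigenvectorBasis hn
  -- By dimension count, V contains a nonzero vector orthogonal to the first i eigenvectors; on it
  -- the quadratic form is at most the i-th eigenvalue (counted from 0).
  let f : V →ₗ[ℝ] ({j : Fin n // j < i} → ℝ) :=
    LinearMap.pi fun j => (innerₛₗ ℝ (b j)).comp V.subtype
  have hf : LinearMap.ker f ≠ ⊥ := by
    apply LinearMap.ker_ne_bot_of_finrank_lt
    rw [Module.finrank_fintype_fun_eq_card, Fintype.card_subtype, Finset.filter_gt_eq_Iio,
      Fin.card_Iio]
    exact hV
  obtain ⟨v, hv, hv0⟩ := (Submodule.ne_bot_iff _).1 hf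
  have hvj : ∀ j < i, inner ℝ (b j) (v : E) = 0 := fun j hj => by
    have := congrFun (LinearMap.mem_ker.1 hv) ⟨j, hj⟩
    simpa [f] using this
  have hpos : 0 < ‖(v : E)‖ ^ 2 := by
    have : (v : E) ≠ 0 := by simpa using hv0
    positivity
  have h1 := h v v.2
  rw [hT.inner_apply_self_eq_sum hn] at h1
  have h2 : ∑ j, hT.eigenvalues hn j * (inner ℝ (b j) (v : E)) ^ 2
      ≤ hT.eigenvalues hn i * ‖(v : E)‖ ^ 2 := by
    rw [b.norm_sq_eq_sum_inner_sq, Finset.mul_sum]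
    refine Finset.sum_le_sum fun j _ => ?_
    rcases lt_or_ge j i with hj | hj
    · simp [hvj j hj]
    · exact mul_le_mul_of_nonneg_right (hT.eigenvalues_antitone hn hj) (sq_nonneg _)
  exact le_of_mul_le_mul_right (h1.trans h2) hpos

/-- Courant–Fischer, upper bound for an eigenvalue. -/
theorem LinearMap.IsSymmetric.eigenvalues_le_of_ker {T : E →ₗ[ℝ] E} (hT : T.IsSymmetric)
    (hn : Module.finrank ℝ E = n) (i : Fin n) {ι : Type*} [Fintype ι] (g : E →ₗ[ℝ] (ι → ℝ))
    (hι : Fintype.card ι ≤ i) (c : ℝ)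
    (h : ∀ v, g v = 0 → inner ℝ (T v) v ≤ c * ‖v‖ ^ 2) : hT.eigenvalues hn i ≤ c := by
  set b := hT.eigenvectorBasis hn
  -- At most i + (n - 1 - i) < n linear conditions, so some nonzero vector of ker g is a combination
  -- of eigenvectors of index at most i.
  let f : E →ₗ[ℝ] ((ι → ℝ) × ({j : Fin n // i < j} → ℝ)) :=
    g.prod (LinearMap.pi fun j => innerₛₗ ℝ (b j))
  have hf : LinearMap.ker f ≠ ⊥ := by
    apply LinearMap.ker_ne_bot_of_finrank_lt
    have : Fintype.card {j : Fin n // i < j} = n - 1 - i := by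
      rw [Fintype.card_subtype, Finset.filter_lt_eq_Ioi, Fin.card_Ioi]
    rw [Module.finrank_prod, Module.finrank_fintype_fun_eq_card,
      Module.finrank_fintype_fun_eq_card, this, hn]
    omega
  obtain ⟨v, hv, hv0⟩ := (Submodule.ne_bot_iff _).1 hf
  have hv' := LinearMap.mem_ker.1 hv
  have hgv : g v = 0 := congrArg Prod.fst hv'
  have hvj : ∀ j > i, inner ℝ (b j) v = 0 := fun j hj => by
    have := congrFun (congrArg Prod.snd hv') ⟨j, hj⟩
    simpa [f] using this
  have hpos : 0 < ‖v‖ ^ 2 := by positivity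
  have h1 := h v hgv
  rw [hT.inner_apply_self_eq_sum hn] at h1
  have h2 : hT.eigenvalues hn i * ‖v‖ ^ 2
      ≤ ∑ j, hT.eigenvalues hn j * (inner ℝ (b j) v) ^ 2 := by
    rw [b.norm_sq_eq_sum_inner_sq, Finset.mul_sum]
    refine Finset.sum_le_sum fun j _ => ?_
    rcases lt_or_ge i j with hj | hj
    · simp [hvj j hj]
    · exact mul_le_mul_of_nonneg_right (hT.eigenvalues_antitone hn hj) (sq_nonneg _)
  exact le_of_mul_le_mul_right (h2.trans h1) hpos

theorem LinearMap.le_singularValues_of_submodule (T : E →ₗ[ℝ] E) (i : ℕ)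
    (hi : i < Module.finrank ℝ E) (V : Submodule ℝ E)
    (hV : i < Module.finrank ℝ V) (c : ℝ) (h : ∀ v ∈ V, c * ‖v‖ ≤ ‖T v‖) :
    c ≤ T.singularValues i := by
  rcases le_or_gt c 0 with hc | hc
  · exact hc.trans (T.singularValues_nonneg i)
  refine le_of_sq_le_sq ?_ (T.singularValues_nonneg i)
  rw [T.sq_singularValues_of_lt rfl hi]
  refine LinearMap.IsSymmetric.le_eigenvalues_of_submodule _ rfl _ V hV _ fun v hv => ?_
  rw [LinearMap.comp_apply, LinearMap.adjoint_inner_left, real_inner_self_eq_norm_sq, ← mul_pow]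
  exact pow_le_pow_left₀ (by positivity) (h v hv) 2

theorem LinearMap.singularValues_le_of_ker (T : E →ₗ[ℝ] E) (i : ℕ)
    (hi : i < Module.finrank ℝ E) {ι : Type*} [Fintype ι] (g : E →ₗ[ℝ] (ι → ℝ))
    (hι : Fintype.card ι ≤ i) (c : ℝ) (hc : 0 ≤ c) (h : ∀ v, g v = 0 → ‖T v‖ ≤ c * ‖v‖) :
    T.singularValues i ≤ c := by
  refine le_of_sq_le_sq ?_ hc
  rw [T.sq_singularValues_of_lt rfl hi]
  refine LinearMap.IsSymmetric.eigenvalues_le_of_ker _ rfl _ g hι _ fun v hv => ?_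
  rw [LinearMap.comp_apply, LinearMap.adjoint_inner_left, real_inner_self_eq_norm_sq, ← mul_pow]
  exact pow_le_pow_left₀ (by positivity) (h v hv) 2

end Minimax

/-! ### Spectrum of a matrix near a finite rank one. -/

section Perturbation

variable {E : Type*} [NormedAddCommGroup E] [InnerProductSpace ℝ E] [FiniteDimensional ℝ E]
  {n k : ℕ} {e : Fin k → E}

/-- The operator `∑ c_j e_j e_jᵀ`. -/
noncomputable def spectralSum (e : Fin k → E) (c : Fin k → ℝ) (v : E) : E :=
  ∑ j, (c j * inner ℝ (e j) v) • e j

theorem inner_spectralSum (c : Fin k → ℝ) (v : E) :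
    inner ℝ (spectralSum e c v) v = ∑ j, c j * inner ℝ (e j) v ^ 2 := by
  simp only [spectralSum, sum_inner, real_inner_smul_left]
  exact Finset.sum_congr rfl fun j _ => by ring

theorem Orthonormal.norm_spectralSum_sq (he : Orthonormal ℝ e) (c : Fin k → ℝ) (v : E) :
    ‖spectralSum e c v‖ ^ 2 = ∑ j, c j ^ 2 * inner ℝ (e j) v ^ 2 := by
  rw [← real_inner_self_eq_norm_sq, spectralSum, he.inner_sum]
  exact Finset.sum_congr rfl fun j _ => by simp; ring

theorem Orthonormal.sum_inner_sq_le (he : Orthonormal ℝ e) (v : E) : ∑ j, inner ℝ (e j) v ^ 2 ≤ ‖v‖ ^ 2 := by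
  simpa using he.sum_inner_products_le (x := v) (s := Finset.univ)

theorem Orthonormal.finrank_span_le (he : Orthonormal ℝ e) (i : Fin k) :
    (i : ℕ) < Module.finrank ℝ (Submodule.span ℝ (Set.range fun j : {j : Fin k // j ≤ i} => e j)) := by
  have hli : LinearIndependent ℝ fun j : {j : Fin k // j ≤ i} => e j :=
    he.linearIndependent.comp _ Subtype.val_injective
  rw [finrank_span_eq_card hli, Fintype.card_subtype, Finset.filter_ge_eq_Iic, Fin.card_Iic]
  omega

theorem Orthonormal.norm_sq_of_mem_span (he : Orthonormal ℝ e) (i : Fin k) {v : E}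
    (hv : v ∈ Submodule.span ℝ (Set.range fun j : {j : Fin k // j ≤ i} => e j)) :
    (∀ j, i < j → inner ℝ (e j) v = 0) ∧ ‖v‖ ^ 2 = ∑ j, inner ℝ (e j) v ^ 2 := by
  have h1 : (∀ j, i < j → inner ℝ (e j) v = 0) ∧ v = ∑ j, inner ℝ (e j) v • e j := by
    induction hv using Submodule.span_induction with
    | mem x hx =>
      obtain ⟨j, rfl⟩ := hx
      refine ⟨fun l hl => he.2 (j.2.trans_lt hl).ne', ?_⟩
      simp [orthonormal_iff_ite.1 he]
    | zero => simp
    | add x y _ _ hx hy =>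
      refine ⟨fun l hl => by rw [inner_add_right, hx.1 l hl, hy.1 l hl, add_zero], ?_⟩
      simp only [inner_add_right, add_smul, Finset.sum_add_distrib]
      rw [← hx.2, ← hy.2]
    | smul a x _ hx =>
      refine ⟨fun l hl => by rw [inner_smul_right, hx.1 l hl, mul_zero], ?_⟩
      simp only [real_inner_smul_right, mul_smul, ← Finset.smul_sum]
      rw [← hx.2]
  refine ⟨h1.1, ?_⟩
  rw [← real_inner_self_eq_norm_sq]
  nth_rw 2 [h1.2]
  simp only [inner_sum, real_inner_smul_right, sq, real_inner_comm]

/-- Eigenvalues of an operator close to a positive finite rank operator. -/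
theorem Orthonormal.abs_eigenvalues_sub_le (he : Orthonormal ℝ e) {T : E →ₗ[ℝ] E} (hT : T.IsSymmetric)
    (hn : Module.finrank ℝ E = n) {c : Fin k → ℝ} (hc : Antitone c) (hc0 : ∀ j, 0 ≤ c j) {δ : ℝ}
    (h : ∀ v, ‖T v - spectralSum e c v‖ ≤ δ * ‖v‖) (i : Fin k) (hi : (i : ℕ) < n) :
    |hT.eigenvalues hn ⟨i, hi⟩ - c i| ≤ δ := by
  have key : ∀ v, |inner ℝ (T v) v - ∑ j, c j * inner ℝ (e j) v ^ 2| ≤ δ * ‖v‖ ^ 2 := fun v => by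
    rw [← inner_spectralSum, ← inner_sub_left]
    refine (abs_real_inner_le_norm _ _).trans ?_
    rw [sq, ← mul_assoc]
    exact mul_le_mul_of_nonneg_right (h v) (norm_nonneg v)
  rw [abs_sub_le_iff]
  constructor
  · rw [sub_le_iff_le_add]
    refine hT.eigenvalues_le_of_ker hn _ (ι := {j : Fin k // j < i})
      (LinearMap.pi fun j => innerₛₗ ℝ (e j)) (by rw [Fintype.card_subtype, Finset.filter_gt_eq_Iio, Fin.card_Iio]) _ fun v hv => ?_
    have hvj : ∀ j < i, inner ℝ (e j) v = 0 := fun j hj => by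
      simpa using congrFun hv ⟨j, hj⟩
    have h1 := (abs_sub_le_iff.1 (key v)).1
    have h2 : ∑ j, c j * inner ℝ (e j) v ^ 2 ≤ c i * ‖v‖ ^ 2 := by
      -- Bessel's inequality enters with the factor `c i`, so its sign matters; in the singular
      -- value version the factor is `c i ^ 2`.
      refine le_trans ?_ (mul_le_mul_of_nonneg_left (he.sum_inner_sq_le v) (hc0 i))
      rw [Finset.mul_sum]
      refine Finset.sum_le_sum fun j _ => ?_
      rcases lt_or_ge j i with hj | hj
      · simp [hvj j hj]
      · exact mul_le_mul_of_nonneg_right (hc hj) (sq_nonneg _)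
    linarith
  · rw [sub_le_iff_le_add, ← sub_le_iff_le_add']
    refine hT.le_eigenvalues_of_submodule hn _ _ (he.finrank_span_le i) _ fun v hv => ?_
    obtain ⟨hvj, hvn⟩ := he.norm_sq_of_mem_span i hv
    have h1 := (abs_sub_le_iff.1 (key v)).2
    have h2 : c i * ‖v‖ ^ 2 ≤ ∑ j, c j * inner ℝ (e j) v ^ 2 := by
      rw [hvn, Finset.mul_sum]
      refine Finset.sum_le_sum fun j _ => ?_
      rcases lt_or_ge i j with hj | hj
      · simp [hvj j hj]
      · exact mul_le_mul_of_nonneg_right (hc hj) (sq_nonneg _)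
    linarith

/-- Singular values of an operator close to a finite rank symmetric operator. -/
theorem Orthonormal.abs_singularValues_sub_le (he : Orthonormal ℝ e) (T : E →ₗ[ℝ] E) {c : Fin k → ℝ}
    (hc : Antitone fun j => |c j|) {δ : ℝ} (hδ : 0 ≤ δ)
    (h : ∀ v, ‖T v - spectralSum e c v‖ ≤ δ * ‖v‖) (i : Fin k)
    (hi : (i : ℕ) < Module.finrank ℝ E) : |T.singularValues i - abs (c i)| ≤ δ := by
  rw [abs_sub_le_iff]
  have hsq : ∀ {i j : Fin k}, i ≤ j → c j ^ 2 ≤ c i ^ 2 := fun hij => sq_le_sq.2 (hc hij)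
  constructor
  · rw [sub_le_iff_le_add]
    refine T.singularValues_le_of_ker _ hi (ι := {j : Fin k // j < i})
      (LinearMap.pi fun j => innerₛₗ ℝ (e j)) (by rw [Fintype.card_subtype, Finset.filter_gt_eq_Iio, Fin.card_Iio]) _ (by positivity)
      fun v hv => ?_
    have hvj : ∀ j < i, inner ℝ (e j) v = 0 := fun j hj => by
      simpa using congrFun hv ⟨j, hj⟩
    have h2 : ‖spectralSum e c v‖ ≤ |c i| * ‖v‖ := by
      refine le_of_sq_le_sq ?_ (by positivity)
      rw [he.norm_spectralSum_sq, mul_pow, sq_abs]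
      refine le_trans ?_ (mul_le_mul_of_nonneg_left (he.sum_inner_sq_le v) (sq_nonneg (c i)))
      rw [Finset.mul_sum]
      refine Finset.sum_le_sum fun j _ => ?_
      rcases lt_or_ge j i with hj | hj
      · simp [hvj j hj]
      · exact mul_le_mul_of_nonneg_right (hsq hj) (sq_nonneg _)
    have := norm_sub_norm_le (T v) (spectralSum e c v)
    linarith [h v]
  · rw [sub_le_iff_le_add, ← sub_le_iff_le_add']
    refine T.le_singularValues_of_submodule _ hi _ (he.finrank_span_le i) _ fun v hv => ?_
    obtain ⟨hvj, hvn⟩ := he.norm_sq_of_mem_span i hv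
    have h2 : |c i| * ‖v‖ ≤ ‖spectralSum e c v‖ := by
      refine le_of_sq_le_sq ?_ (by positivity)
      rw [he.norm_spectralSum_sq, mul_pow, sq_abs, hvn, Finset.mul_sum]
      refine Finset.sum_le_sum fun j _ => ?_
      rcases lt_or_ge i j with hj | hj
      · simp [hvj j hj]
      · exact mul_le_mul_of_nonneg_right (hsq hj) (sq_nonneg _)
    have := norm_sub_norm_le (spectralSum e c v) (T v)
    rw [norm_sub_rev] at this
    linarith [h v]

end Perturbation

/-! ### Nets in the unit ball by volume comparison. -/

section Net

/-- Cardinality of a separated subset of the unit ball of a finite-dimensional normed space. -/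
theorem card_le_of_separated_unitBall {F : Type*} [NormedAddCommGroup F] [NormedSpace ℝ F]
    [FiniteDimensional ℝ F] {ε : ℝ} (hε : 0 < ε) (s : Finset F) (hs : ∀ x ∈ s, ‖x‖ ≤ 1)
    (h : ∀ x ∈ s, ∀ y ∈ s, x ≠ y → ε ≤ ‖x - y‖) :
    (s.card : ℝ) ≤ (1 + 2 / ε) ^ Module.finrank ℝ F := by
  borelize F
  let μ : Measure F := Measure.addHaar
  have hdisj : Set.PairwiseDisjoint (s : Set F) fun x => Metric.ball x (ε / 2) := by
    intro x hx y hy hxy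
    apply Metric.ball_disjoint_ball
    rw [dist_eq_norm]
    linarith [h x hx y hy hxy]
  have hsub : (⋃ x ∈ s, Metric.ball x (ε / 2)) ⊆ Metric.ball (0 : F) (1 + ε / 2) := by
    refine Set.iUnion₂_subset fun x hx => Metric.ball_subset_ball' ?_
    rw [dist_zero_right]
    linarith [hs x hx]
  have hμ : ∀ (x : F) {r : ℝ}, 0 < r →
      μ (Metric.ball x r) = ENNReal.ofReal (r ^ Module.finrank ℝ F) * μ (Metric.ball 0 1) :=
    fun x r hr => Measure.addHaar_ball_of_pos μ x hr
  have h1 : (s.card : ENNReal) * ENNReal.ofReal ((ε / 2) ^ Module.finrank ℝ F)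
        * μ (Metric.ball 0 1)
      ≤ ENNReal.ofReal ((1 + ε / 2) ^ Module.finrank ℝ F) * μ (Metric.ball 0 1) := by
    calc _ = ∑ x ∈ s, μ (Metric.ball x (ε / 2)) := by
          simp only [hμ _ (half_pos hε), Finset.sum_const, nsmul_eq_mul, mul_assoc]
      _ = μ (⋃ x ∈ s, Metric.ball x (ε / 2)) :=
          (measure_biUnion_finset hdisj fun x _ => measurableSet_ball).symm
      _ ≤ μ (Metric.ball 0 (1 + ε / 2)) := measure_mono hsub
      _ = _ := hμ 0 (by positivity)
  have h2 := (ENNReal.mul_le_mul_iff_left (Metric.measure_ball_pos μ 0 one_pos).ne'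
    measure_ball_lt_top.ne).1 h1
  rw [← ENNReal.ofReal_natCast, ← ENNReal.ofReal_mul (by positivity),
    ENNReal.ofReal_le_ofReal_iff (by positivity)] at h2
  have h3 : (1 + 2 / ε) = (1 + ε / 2) / (ε / 2) := by field_simp; ring
  rw [h3, div_pow, le_div_iff₀ (by positivity)]
  exact h2

/-- A separated set of maximal cardinality is a net: an uncovered point could be added to it. The
volume bound ensures that the maximum exists. -/
theorem exists_unitBall_net (F : Type*) [NormedAddCommGroup F] [NormedSpace ℝ F]
    [FiniteDimensional ℝ F] {ε : ℝ} (hε : 0 < ε) :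
    ∃ s : Finset F, (s.card : ℝ) ≤ (1 + 2 / ε) ^ Module.finrank ℝ F ∧ (∀ x ∈ s, ‖x‖ ≤ 1) ∧
      ∀ x : F, ‖x‖ ≤ 1 → ∃ y ∈ s, ‖x - y‖ ≤ ε := by
  classical
  let P : ℕ → Prop := fun m => ∃ s : Finset F, s.card = m ∧ (∀ x ∈ s, ‖x‖ ≤ 1) ∧
    ∀ x ∈ s, ∀ y ∈ s, x ≠ y → ε ≤ ‖x - y‖
  have hP0 : P 0 := ⟨∅, by simp⟩
  have hb : ∀ m, P m → m ≤ ⌊(1 + 2 / ε) ^ Module.finrank ℝ F⌋₊ := by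
    rintro m ⟨s, rfl, h1, h2⟩
    exact Nat.le_floor (card_le_of_separated_unitBall hε s h1 h2)
  obtain ⟨s, hs, h1, h2⟩ : P (Nat.findGreatest P ⌊(1 + 2 / ε) ^ Module.finrank ℝ F⌋₊) :=
    Nat.findGreatest_spec (Nat.zero_le _) hP0
  refine ⟨s, card_le_of_separated_unitBall hε s h1 h2, h1, fun x hx => ?_⟩
  by_contra! hcon
  have hxs : x ∉ s := fun h => by
    have := hcon x h
    simp at this
    linarith
  have hP : P (s.card + 1) := by
    refine ⟨insert x s, Finset.card_insert_of_notMem hxs, ?_, ?_⟩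
    · intro y hy
      rcases Finset.mem_insert.1 hy with rfl | hy
      exacts [hx, h1 y hy]
    · intro y hy z hz hyz
      rcases Finset.mem_insert.1 hy with hy | hy <;> rcases Finset.mem_insert.1 hz with hz | hz
      · exact absurd (hy.trans hz.symm) hyz
      · rw [hy]; exact (hcon z hz).le
      · rw [hz, norm_sub_rev]; exact (hcon y hy).le
      · exact h2 y hy z hz hyz
  have := Nat.le_findGreatest (hb _ hP) hP
  omega

end Net

/-! ### Leading spectral part as a pairing with matrices of rank at most k. -/

section Pairing

variable {n k : ℕ}

/-- The entries of a matrix as a vector of a Euclidean space. -/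
noncomputable def entryVec (D : Matrix (Fin n) (Fin n) ℝ) : EuclideanSpace ℝ (Fin n × Fin n) :=
  WithLp.toLp 2 fun p => D p.1 p.2

/-- The rank one matrix `w uᵀ`. -/
noncomputable def outerVec (w u : EuclideanSpace ℝ (Fin n)) : EuclideanSpace ℝ (Fin n × Fin n) :=
  WithLp.toLp 2 fun p => w p.1 * u p.2

/-- The matrix `∑ w_i u_iᵀ`. -/
noncomputable def rankSum (u w : Fin k → EuclideanSpace ℝ (Fin n)) :
    EuclideanSpace ℝ (Fin n × Fin n) := ∑ i, outerVec (w i) (u i)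

theorem inner_entryVec (D : Matrix (Fin n) (Fin n) ℝ) (B : EuclideanSpace ℝ (Fin n × Fin n)) :
    inner ℝ (entryVec D) B = ∑ p : Fin n × Fin n, D p.1 p.2 * B p := by
  simp [PiLp.inner_apply, entryVec, mul_comm]

theorem inner_outerVec (w u w' u' : EuclideanSpace ℝ (Fin n)) :
    inner ℝ (outerVec w u) (outerVec w' u') = inner ℝ w w' * inner ℝ u u' := by
  simp only [PiLp.inner_apply, outerVec, Finset.sum_mul_sum, Fintype.sum_prod_type]
  refine Finset.sum_congr rfl fun i _ => Finset.sum_congr rfl fun j _ => ?_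
  simp
  ring

theorem norm_outerVec (w u : EuclideanSpace ℝ (Fin n)) : ‖outerVec w u‖ = ‖w‖ * ‖u‖ := by
  rw [← sq_eq_sq₀ (norm_nonneg _) (by positivity), ← real_inner_self_eq_norm_sq, inner_outerVec,
    real_inner_self_eq_norm_sq, real_inner_self_eq_norm_sq, mul_pow]

theorem outerVec_sub_left (w w' u : EuclideanSpace ℝ (Fin n)) :
    outerVec (w - w') u = outerVec w u - outerVec w' u := by
  ext p; simp [outerVec, sub_mul]

theorem outerVec_sub_right (w u u' : EuclideanSpace ℝ (Fin n)) :
    outerVec w (u - u') = outerVec w u - outerVec w u' := by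
  ext p; simp [outerVec, mul_sub]

theorem inner_entryVec_outerVec (D : Matrix (Fin n) (Fin n) ℝ) (w u : EuclideanSpace ℝ (Fin n)) :
    inner ℝ (entryVec D) (outerVec w u) = inner ℝ (Matrix.toEuclideanLin D u) w := by
  rw [inner_entryVec, Fintype.sum_prod_type]
  simp only [PiLp.inner_apply, Matrix.toLpLin_apply, Matrix.mulVec, dotProduct, outerVec]
  refine Finset.sum_congr rfl fun i _ => ?_
  simp only [Real.inner_apply, Finset.sum_mul]
  refine Finset.sum_congr rfl fun j _ => ?_
  ring

theorem continuous_outerVec :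
    Continuous fun p : EuclideanSpace ℝ (Fin n) × EuclideanSpace ℝ (Fin n) => outerVec p.1 p.2 := by
  unfold outerVec
  fun_prop

theorem continuous_rankSum : Continuous
    fun p : (Fin k → EuclideanSpace ℝ (Fin n)) × (Fin k → EuclideanSpace ℝ (Fin n)) =>
      rankSum p.1 p.2 := by
  unfold rankSum
  refine continuous_finsetSum _ fun i _ => continuous_outerVec.comp (f := fun p :
    (Fin k → EuclideanSpace ℝ (Fin n)) × (Fin k → EuclideanSpace ℝ (Fin n)) => (p.2 i, p.1 i)) ?_
  fun_prop

/-- Orthogonality of the `u i` alone kills the cross terms, so the `w i` may be arbitrary. -/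
theorem norm_rankSum_le_one {u w : Fin k → EuclideanSpace ℝ (Fin n)} (hu : ∀ i, ‖u i‖ ≤ 1)
    (huo : ∀ i j, i ≠ j → inner ℝ (u i) (u j) = 0) (hw : ∑ i, ‖w i‖ ^ 2 ≤ 1) :
    ‖rankSum u w‖ ≤ 1 := by
  rw [← sq_le_one_iff₀ (norm_nonneg _), ← real_inner_self_eq_norm_sq, rankSum, sum_inner]
  simp only [inner_sum, inner_outerVec]
  refine le_trans (Finset.sum_le_sum fun i _ => ?_) hw
  rw [Finset.sum_eq_single i (fun j _ hj => by rw [huo i j hj.symm, mul_zero]) (by simp),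
    real_inner_self_eq_norm_sq, real_inner_self_eq_norm_sq]
  exact mul_le_of_le_one_right (sq_nonneg _) (pow_le_one₀ (norm_nonneg _) (hu i))

theorem norm_rankSum_sub_le {u w u' w' : Fin k → EuclideanSpace ℝ (Fin n)} {ε : ℝ}
    (hw : ∀ i, ‖w i‖ ≤ 1) (hu' : ∀ i, ‖u' i‖ ≤ 1) (huu : ∀ i, ‖u i - u' i‖ ≤ ε)
    (hww : ∀ i, ‖w i - w' i‖ ≤ ε) : ‖rankSum u w - rankSum u' w'‖ ≤ 2 * k * ε := by
  rw [rankSum, rankSum, ← Finset.sum_sub_distrib]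
  refine (norm_sum_le_of_le _ (f := fun i => outerVec (w i) (u i) - outerVec (w' i) (u' i))
    (n := fun _ => 2 * ε) fun i _ => ?_).trans (by simp; linarith)
  have : outerVec (w i) (u i) - outerVec (w' i) (u' i)
      = outerVec (w i) (u i - u' i) + outerVec (w i - w' i) (u' i) := by
    rw [outerVec_sub_left, outerVec_sub_right]; abel
  rw [this]
  refine (norm_add_le _ _).trans ?_
  rw [norm_outerVec, norm_outerVec]
  have h1 : ‖w i‖ * ‖u i - u' i‖ ≤ 1 * ε :=
    mul_le_mul (hw i) (huu i) (norm_nonneg _) zero_le_one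
  have h2 : ‖w i - w' i‖ * ‖u' i‖ ≤ ε * 1 :=
    mul_le_mul (hww i) (hu' i) (norm_nonneg _) ((norm_nonneg _).trans (hww i))
  linarith

theorem inner_outerVec_le_of_unit {X : EuclideanSpace ℝ (Fin n × Fin n)} {R : ℝ}
    (h : ∀ w u : EuclideanSpace ℝ (Fin n), ‖w‖ = 1 → ‖u‖ = 1 → inner ℝ X (outerVec w u) ≤ R)
    (y x : EuclideanSpace ℝ (Fin n)) : inner ℝ X (outerVec y x) ≤ R * (‖y‖ * ‖x‖) := by
  rcases eq_or_ne y 0 with rfl | hy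
  · have : outerVec 0 x = 0 := by ext p; simp [outerVec]
    simp [this]
  rcases eq_or_ne x 0 with rfl | hx
  · have : outerVec y 0 = 0 := by ext p; simp [outerVec]
    simp [this]
  have h1 := h (‖y‖⁻¹ • y) (‖x‖⁻¹ • x) (norm_smul_inv_norm hy) (norm_smul_inv_norm hx)
  have h2 : outerVec (‖y‖⁻¹ • y) (‖x‖⁻¹ • x) = (‖y‖ * ‖x‖)⁻¹ • outerVec y x := by
    ext p; simp [outerVec]; ring
  have hpos : 0 < ‖y‖ * ‖x‖ := mul_pos (norm_pos_iff.2 hy) (norm_pos_iff.2 hx)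
  rw [h2, real_inner_smul_right, inv_mul_eq_div, div_le_iff₀ hpos] at h1
  exact h1

/-- The discretization error is controlled by the operator norm of X, because the difference splits
into 2k rank one terms. The Hilbert–Schmidt norm of X would be far too large here. -/
theorem inner_rankSum_sub_le {X : EuclideanSpace ℝ (Fin n × Fin n)} {R : ℝ} (hR : 0 ≤ R)
    (h : ∀ w u : EuclideanSpace ℝ (Fin n), inner ℝ X (outerVec w u) ≤ R * (‖w‖ * ‖u‖))
    {u w u' w' : Fin k → EuclideanSpace ℝ (Fin n)} {ε : ℝ} (hε : 0 ≤ ε)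
    (hw : ∀ i, ‖w i‖ ≤ 1) (hu' : ∀ i, ‖u' i‖ ≤ 1) (huu : ∀ i, ‖u i - u' i‖ ≤ ε)
    (hww : ∀ i, ‖w i - w' i‖ ≤ ε) :
    inner ℝ X (rankSum u w) - inner ℝ X (rankSum u' w') ≤ 2 * k * ε * R := by
  rw [← inner_sub_right, rankSum, rankSum, ← Finset.sum_sub_distrib, inner_sum]
  refine (Finset.sum_le_card_nsmul _ _ (2 * ε * R) fun i _ => ?_).trans (by simp; linarith)
  have : outerVec (w i) (u i) - outerVec (w' i) (u' i)
      = outerVec (w i) (u i - u' i) + outerVec (w i - w' i) (u' i) := by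
    rw [outerVec_sub_left, outerVec_sub_right]; abel
  rw [this, inner_add_right]
  have h1 : ‖w i‖ * ‖u i - u' i‖ ≤ 1 * ε :=
    mul_le_mul (hw i) (huu i) (norm_nonneg _) zero_le_one
  have h2 : ‖w i - w' i‖ * ‖u' i‖ ≤ ε * 1 :=
    mul_le_mul (hww i) (hu' i) (norm_nonneg _) hε
  have h3 := (h (w i) (u i - u' i)).trans (mul_le_mul_of_nonneg_left h1 hR)
  have h4 := (h (w i - w' i) (u' i)).trans (mul_le_mul_of_nonneg_left h2 hR)
  linarith


/-- The pairing with matrices of rank at most `k` and norm at most one attains its maximum, which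
dominates the operator norm. -/
theorem exists_max_pairing (hk : 1 ≤ k) (X : EuclideanSpace ℝ (Fin n × Fin n))
    (u w : Fin k → EuclideanSpace ℝ (Fin n)) (hu : ∀ i, ‖u i‖ ≤ 1) (hw : ∀ i, ‖w i‖ ≤ 1)
    (hB : ‖rankSum u w‖ ≤ 1) :
    ∃ u₀ w₀ : Fin k → EuclideanSpace ℝ (Fin n), (∀ i, ‖u₀ i‖ ≤ 1) ∧ (∀ i, ‖w₀ i‖ ≤ 1) ∧
      ‖rankSum u₀ w₀‖ ≤ 1 ∧ inner ℝ X (rankSum u w) ≤ inner ℝ X (rankSum u₀ w₀) ∧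
      ∀ y x : EuclideanSpace ℝ (Fin n), ‖y‖ = 1 → ‖x‖ = 1 →
        inner ℝ X (outerVec y x) ≤ inner ℝ X (rankSum u₀ w₀) := by
  let S : Set ((Fin k → EuclideanSpace ℝ (Fin n)) × (Fin k → EuclideanSpace ℝ (Fin n))) :=
    {p | ‖p‖ ≤ 1 ∧ ‖rankSum p.1 p.2‖ ≤ 1}
  have hball : ∀ p : (Fin k → EuclideanSpace ℝ (Fin n)) × (Fin k → EuclideanSpace ℝ (Fin n)),
      ‖p‖ ≤ 1 ↔ (∀ i, ‖p.1 i‖ ≤ 1) ∧ ∀ i, ‖p.2 i‖ ≤ 1 := fun p => by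
    rw [Prod.norm_def, max_le_iff, pi_norm_le_iff_of_nonneg zero_le_one,
      pi_norm_le_iff_of_nonneg zero_le_one]
  have hScl : IsClosed S := (isClosed_le continuous_norm continuous_const).inter
    (isClosed_le continuous_rankSum.norm continuous_const)
  have hS : IsCompact S := (isCompact_closedBall 0 1).of_isClosed_subset hScl
    fun p hp => by simpa using hp.1
  have hmem : (u, w) ∈ S := ⟨(hball _).2 ⟨hu, hw⟩, hB⟩
  have hφ : Continuous
      fun p : (Fin k → EuclideanSpace ℝ (Fin n)) × (Fin k → EuclideanSpace ℝ (Fin n)) =>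
        (inner ℝ X (rankSum p.1 p.2) : ℝ) := continuous_const.inner continuous_rankSum
  obtain ⟨p₀, hmem₀, hmax⟩ := hS.exists_isMaxOn ⟨_, hmem⟩ hφ.continuousOn
  have hmax' : ∀ p ∈ S, inner ℝ X (rankSum p.1 p.2) ≤ inner ℝ X (rankSum p₀.1 p₀.2) :=
    isMaxOn_iff.1 hmax
  clear hmax hφ hScl hS
  obtain ⟨u₀, w₀⟩ := p₀
  have h1 : ‖(u₀, w₀)‖ ≤ 1 := hmem₀.1
  have h2 : ‖rankSum u₀ w₀‖ ≤ 1 := hmem₀.2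
  have h₀ := (hball _).1 h1
  refine ⟨u₀, w₀, h₀.1, h₀.2, h2, hmax' (u, w) hmem, fun y x hy hx => ?_⟩
  -- Since k ≥ 1, rank one matrices are competitors in the maximization.
  let i₀ : Fin k := ⟨0, hk⟩
  let ux : Fin k → EuclideanSpace ℝ (Fin n) := fun i => if i = i₀ then x else 0
  let wy : Fin k → EuclideanSpace ℝ (Fin n) := fun i => if i = i₀ then y else 0
  have hsum : rankSum ux wy = outerVec y x := by
    rw [rankSum, Finset.sum_eq_single i₀]
    · simp [ux, wy]
    · intro i _ hi
      ext p
      simp [ux, wy, hi, outerVec]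
    · simp
  have hS' : (ux, wy) ∈ S := by
    refine ⟨(hball _).2 ⟨fun i => ?_, fun i => ?_⟩, ?_⟩
    · by_cases h : i = i₀ <;> simp [ux, h, hx]
    · by_cases h : i = i₀ <;> simp [wy, h, hy]
    · simp only [hsum, norm_outerVec, hx, hy, mul_one, le_refl]
  rw [← hsum]
  exact hmax' (ux, wy) hS'

/-- A finite family of matrices testing the size of the leading part of an arbitrary matrix. -/
theorem exists_net_pairing (hk : 1 ≤ k) (n : ℕ) {ε : ℝ} (hε : 0 < ε) (hε1 : 2 * k * ε ≤ 1) :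
    ∃ N : Finset (EuclideanSpace ℝ (Fin n × Fin n)), (N.card : ℝ) ≤ (1 + 2 / ε) ^ (2 * k * n) ∧
      (∀ B ∈ N, ‖B‖ ≤ 1 + 2 * k * ε) ∧
      ∀ (X : EuclideanSpace ℝ (Fin n × Fin n)) (ρ : ℝ) (u w : Fin k → EuclideanSpace ℝ (Fin n)),
        0 ≤ ρ → (∀ i, ‖u i‖ ≤ 1) → (∀ i, ‖w i‖ ≤ 1) → ‖rankSum u w‖ ≤ 1 →
        ρ ≤ inner ℝ X (rankSum u w) → ∃ B ∈ N, (1 - 2 * k * ε) * ρ ≤ inner ℝ X B := by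
  classical
  obtain ⟨s, hcard, hs1, hsnet⟩ := exists_unitBall_net
    ((Fin k → EuclideanSpace ℝ (Fin n)) × (Fin k → EuclideanSpace ℝ (Fin n))) hε
  have hdim : Module.finrank ℝ
      ((Fin k → EuclideanSpace ℝ (Fin n)) × (Fin k → EuclideanSpace ℝ (Fin n)))
      = 2 * k * n := by
    simp only [Module.finrank_prod, Module.finrank_pi_fintype, finrank_euclideanSpace_fin]
    simp
    ring
  rw [hdim] at hcard
  have hball : ∀ (r : ℝ), 0 ≤ r →
      ∀ p : (Fin k → EuclideanSpace ℝ (Fin n)) × (Fin k → EuclideanSpace ℝ (Fin n)),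
      ‖p‖ ≤ r ↔ (∀ i, ‖p.1 i‖ ≤ r) ∧ ∀ i, ‖p.2 i‖ ≤ r := fun r hr p => by
    rw [Prod.norm_def, max_le_iff, pi_norm_le_iff_of_nonneg hr, pi_norm_le_iff_of_nonneg hr]
  refine ⟨(s.image fun p => rankSum p.1 p.2).filter fun B => ‖B‖ ≤ 1 + 2 * k * ε, ?_,
    fun B hB => (Finset.mem_filter.1 hB).2, ?_⟩
  · refine le_trans ?_ hcard
    exact_mod_cast (Finset.card_filter_le _ _).trans Finset.card_image_le
  intro X ρ u w hρ hu hw hB hle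
  -- The net point is taken near the maximizer for X and not near the given (u, w). The maximum
  -- bounds the operator norm of X, so the error is a 2kε fraction of the maximum.
  obtain ⟨u₀, w₀, hu₀, hw₀, hB₀, hmax, hop⟩ := exists_max_pairing hk X u w hu hw hB
  have hR0 := hρ.trans (hle.trans hmax)
  obtain ⟨⟨u', w'⟩, hps, hpd⟩ := hsnet (u₀, w₀) ((hball 1 zero_le_one (u₀, w₀)).2 ⟨hu₀, hw₀⟩)
  have hd : (∀ i, ‖u₀ i - u' i‖ ≤ ε) ∧ ∀ i, ‖w₀ i - w' i‖ ≤ ε :=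
    (hball ε hε.le ((u₀, w₀) - (u', w'))).1 hpd
  have hp' : (∀ i, ‖u' i‖ ≤ 1) ∧ ∀ i, ‖w' i‖ ≤ 1 :=
    (hball 1 zero_le_one (u', w')).1 (hs1 (u', w') hps)
  refine ⟨rankSum u' w', Finset.mem_filter.2 ⟨Finset.mem_image.2 ⟨(u', w'), hps, rfl⟩, ?_⟩, ?_⟩
  · have := norm_rankSum_sub_le hw₀ hp'.1 hd.1 hd.2
    have h3 := norm_sub_norm_le (rankSum u' w') (rankSum u₀ w₀)
    rw [norm_sub_rev] at h3
    linarith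
  · have h4 := inner_rankSum_sub_le hR0 (inner_outerVec_le_of_unit hop) hε.le hw₀ hp'.1 hd.1 hd.2
    have : (1 - 2 * k * ε) * ρ ≤ (1 - 2 * k * ε) * inner ℝ X (rankSum u₀ w₀) :=
      mul_le_mul_of_nonneg_left (hle.trans hmax) (by linarith)
    linarith


/-- The optimal B is the truncation of T to the span of the first k basis vectors, normalized in
Hilbert–Schmidt norm; pairing with it recovers that norm. -/
theorem exists_rankSum_ge (T : Matrix (Fin n) (Fin n) ℝ) {m : ℕ}
    (b : OrthonormalBasis (Fin m) ℝ (EuclideanSpace ℝ (Fin n))) (x : EuclideanSpace ℝ (Fin k))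
    (hx : ∀ (i : Fin k) (h : (i : ℕ) < m), |x i| ≤ ‖Matrix.toEuclideanLin T (b ⟨i, h⟩)‖)
    (hx0 : ∀ i : Fin k, m ≤ (i : ℕ) → x i = 0) :
    ∃ u w : Fin k → EuclideanSpace ℝ (Fin n), (∀ i, ‖u i‖ ≤ 1) ∧ (∀ i, ‖w i‖ ≤ 1) ∧
      ‖rankSum u w‖ ≤ 1 ∧ ‖x‖ ≤ inner ℝ (entryVec T) (rankSum u w) := by
  let u : Fin k → EuclideanSpace ℝ (Fin n) := fun i => if h : (i : ℕ) < m then b ⟨i, h⟩ else 0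
  let S := ∑ i, ‖Matrix.toEuclideanLin T (u i)‖ ^ 2
  have hS0 : 0 ≤ S := Finset.sum_nonneg fun i _ => sq_nonneg _
  -- For S = 0 the convention `0⁻¹ = 0` makes every `w i` vanish, and the formulas below remain
  -- valid.
  let w : Fin k → EuclideanSpace ℝ (Fin n) := fun i => (√S)⁻¹ • Matrix.toEuclideanLin T (u i)
  have hu : ∀ i, ‖u i‖ ≤ 1 := fun i => by
    by_cases h : (i : ℕ) < m <;> simp [u, h]
  have huo : ∀ i j, i ≠ j → inner ℝ (u i) (u j) = 0 := fun i j hij => by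
    by_cases h : (i : ℕ) < m <;> by_cases h' : (j : ℕ) < m <;> simp [u, h, h']
    exact b.orthonormal.2 fun h => hij (Fin.ext (by simpa using h))
  have hw : ∑ i, ‖w i‖ ^ 2 ≤ 1 := by
    simp only [w, norm_smul, mul_pow, ← Finset.mul_sum]
    rw [norm_inv, inv_pow, Real.norm_of_nonneg (Real.sqrt_nonneg _), Real.sq_sqrt hS0]
    exact inv_mul_le_one
  have hw1 : ∀ i, ‖w i‖ ≤ 1 := fun i => by
    rw [← sq_le_one_iff₀ (norm_nonneg _)]
    exact (Finset.single_le_sum (f := fun i => ‖w i‖ ^ 2) (fun i _ => sq_nonneg _)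
      (Finset.mem_univ i)).trans hw
  refine ⟨u, w, hu, hw1, norm_rankSum_le_one hu huo hw, ?_⟩
  have h1 : inner ℝ (entryVec T) (rankSum u w) = √S := by
    simp only [rankSum, inner_sum, inner_entryVec_outerVec, w, real_inner_smul_right,
      real_inner_self_eq_norm_sq, ← Finset.mul_sum]
    change (√S)⁻¹ * S = √S
    rw [inv_mul_eq_div, Real.div_sqrt]
  rw [h1]
  refine Real.le_sqrt_of_sq_le ?_
  rw [EuclideanSpace.real_norm_sq_eq]
  refine Finset.sum_le_sum fun i _ => ?_
  by_cases h : (i : ℕ) < m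
  · rw [← sq_abs]
    simpa [u, h] using pow_le_pow_left₀ (abs_nonneg _) (hx i h) 2
  · simp only [hx0 i (not_lt.1 h)]
    simp only [ne_eq, OfNat.ofNat_ne_zero, not_false_eq_true, zero_pow]
    exact sq_nonneg _

theorem topSingularValues_exists_rankSum_ge (k : ℕ) (M : Matrix (Fin n) (Fin n) ℝ) :
    ∃ u w : Fin k → EuclideanSpace ℝ (Fin n), (∀ i, ‖u i‖ ≤ 1) ∧ (∀ i, ‖w i‖ ≤ 1) ∧
      ‖rankSum u w‖ ≤ 1 ∧
      ‖topSingularValues k M‖ ≤ inner ℝ (entryVec M) (rankSum u w) := by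
  let T := Matrix.toEuclideanLin M
  have hn : Module.finrank ℝ (EuclideanSpace ℝ (Fin n)) = n := finrank_euclideanSpace_fin
  let b := T.isSymmetric_adjoint_comp_self.eigenvectorBasis hn
  refine exists_rankSum_ge M b _ (fun i h => ?_) fun i h => ?_
  · change |T.singularValues i| ≤ ‖T (b ⟨i, h⟩)‖
    rw [abs_of_nonneg (T.singularValues_nonneg i)]
    refine le_of_eq ((sq_eq_sq₀ (T.singularValues_nonneg i) (norm_nonneg _)).1 ?_)
    rw [T.sq_singularValues_of_lt hn h, ← real_inner_self_eq_norm_sq,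
      ← LinearMap.adjoint_inner_left, ← LinearMap.comp_apply,
      T.isSymmetric_adjoint_comp_self.apply_eigenvectorBasis hn]
    simp [real_inner_smul_left, b]
  · exact LinearMap.singularValues_of_finrank_le _ (by rw [hn]; exact h)

theorem topEigenvalues_exists_rankSum_ge (k : ℕ) {M : Matrix (Fin n) (Fin n) ℝ}
    (hM : M.IsHermitian) :
    ∃ u w : Fin k → EuclideanSpace ℝ (Fin n), (∀ i, ‖u i‖ ≤ 1) ∧ (∀ i, ‖w i‖ ≤ 1) ∧
      ‖rankSum u w‖ ≤ 1 ∧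
      ‖topEigenvalues k hM‖ ≤ inner ℝ (entryVec M) (rankSum u w) := by
  let b := (Matrix.isSymmetric_toEuclideanLin_iff.mpr hM).eigenvectorBasis finrank_euclideanSpace
  refine exists_rankSum_ge M b _ (fun i h => ?_) fun i h => ?_
  · rw [(Matrix.isSymmetric_toEuclideanLin_iff.mpr hM).apply_eigenvectorBasis
      finrank_euclideanSpace, norm_smul, OrthonormalBasis.norm_eq_one, mul_one]
    change |dite _ _ _| ≤ _
    rw [dif_pos h]
    rfl
  · change dite _ _ _ = _
    rw [dif_neg (not_lt.2 h)]

end Pairing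

/-! ### Convex duality for the cumulant-generating function. -/

section Legendre

/-- Convex, twice differentiable functions vanishing at the origin with a quadratic upper bound. -/
structure IsConvexSubquadratic (f : ℝ → ℝ) (C : ℝ) : Prop where
  diff : Differentiable ℝ f
  diff_deriv : Differentiable ℝ (deriv f)
  map_zero : f 0 = 0
  pos : 0 < C
  le : ∀ t, f t ≤ C * t ^ 2
  convex : ConvexOn ℝ Set.univ f

theorem tendsto_div_sq_of_deriv_zero {h : ℝ → ℝ} (hd : Differentiable ℝ h) (h0 : h 0 = 0)
    (h0' : deriv h 0 = 0) {a : ℝ} (ha : HasDerivAt (deriv h) a 0) :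
    Tendsto (fun b => h b / b ^ 2) (𝓝[≠] 0) (𝓝 (a / 2)) := by
  refine HasDerivAt.lhopital_zero_nhdsNE (f' := deriv h) (g' := fun b => 2 * b)
    (.of_forall fun x => (hd x).hasDerivAt)
    (.of_forall fun x => by simpa using hasDerivAt_pow 2 x) ?_ ?_ ?_ ?_
  · filter_upwards [self_mem_nhdsWithin] with x hx
    simpa using hx
  · have := (hd 0).continuousAt.tendsto
    rw [h0] at this
    exact this.mono_left nhdsWithin_le_nhds
  · have : Tendsto (fun x : ℝ => x ^ 2) (𝓝 0) (𝓝 0) := by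
      simpa using (continuous_pow 2).tendsto (0 : ℝ)
    exact this.mono_left nhdsWithin_le_nhds
  · have := (hasDerivAt_iff_tendsto_slope.1 ha).div_const 2
    refine this.congr fun x => ?_
    rw [slope_def_field, h0']
    simp [div_div, mul_comm]

variable {f : ℝ → ℝ} {C : ℝ}

theorem le_legendre (f : ℝ → ℝ) (x y : ℝ) : ((x * y - f x : ℝ) : EReal) ≤ legendre f y :=
  le_iSup (fun x : ℝ => ((x * y - f x : ℝ) : EReal)) x

namespace IsConvexSubquadratic

/-- The difference f(t) - C t² is maximal at 0. For cumulant-generating functions this says that a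
subgaussian variable is centred. -/
theorem deriv_zero (hf : IsConvexSubquadratic f C) : deriv f 0 = 0 := by
  have h1 : IsLocalMax (fun t => f t - C * t ^ 2) 0 := by
    refine .of_forall fun t => ?_
    simp only [hf.map_zero]
    linarith [hf.le t]
  have h2 : HasDerivAt (fun t => f t - C * t ^ 2) (deriv f 0 - C * (2 * 0)) 0 := by
    have := (hasDerivAt_pow 2 (0 : ℝ)).const_mul C
    exact (hf.diff 0).hasDerivAt.sub (by simpa using this)
  have := h1.hasDerivAt_eq_zero h2
  linarith

theorem tangent_le (hf : IsConvexSubquadratic f C) (t u : ℝ) :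
    f t + deriv f t * (u - t) ≤ f u := by
  rcases lt_trichotomy t u with h | rfl | h
  · have := hf.convex.deriv_le_slope (Set.mem_univ t) (Set.mem_univ u) h (hf.diff t)
    rw [slope_def_field, le_div_iff₀ (by linarith)] at this
    linarith
  · simp
  · have := hf.convex.slope_le_deriv (Set.mem_univ u) (Set.mem_univ t) h (hf.diff t)
    rw [slope_def_field, div_le_iff₀ (by linarith)] at this
    linarith

theorem legendre_deriv_le (hf : IsConvexSubquadratic f C) (t : ℝ) :
    legendre f (deriv f t) ≤ ((t * deriv f t - f t : ℝ) : EReal) := by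
  refine iSup_le fun x => EReal.coe_le_coe_iff.2 ?_
  linarith [hf.tangent_le t x]

theorem reflect (hf : IsConvexSubquadratic f C) : IsConvexSubquadratic (fun t => f (-t)) C := by
  have hd : deriv (fun t => f (-t)) = fun t => -deriv f (-t) := by
    ext t; exact deriv_comp_neg f t
  refine ⟨hf.diff.comp differentiable_neg, ?_, by simpa using hf.map_zero, hf.pos,
    fun t => by simpa using hf.le (-t), ?_⟩
  · rw [hd]
    exact (hf.diff_deriv.comp differentiable_neg).neg
  · have := hf.convex.comp_linearMap (-LinearMap.id : ℝ →ₗ[ℝ] ℝ)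
    simpa [Function.comp_def] using this

theorem legendre_reflect (f : ℝ → ℝ) (s : ℝ) : legendre (fun t => f (-t)) s = legendre f (-s) := by
  unfold legendre
  rw [← (Equiv.neg ℝ).iSup_comp]
  simp

/-- A quadratic lower bound for the Legendre transform gives a quadratic upper bound. -/
theorem le_of_le_legendreRatio (hf : IsConvexSubquadratic f C) {J : ℝ} (hJ : 0 < J)
    (h : (J : EReal) ≤ ⨅ s, legendreRatio f s) (t : ℝ) : f t ≤ 1 / (4 * J) * t ^ 2 := by
  -- At the slope s the transform is at most ts - f(t), so f(t) ≤ ts - Js² ≤ t²/(4J) by completing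
  -- the square.
  set s := deriv f t with hs
  have h1 := hf.tangent_le t 0
  rw [hf.map_zero, ← hs] at h1
  rcases eq_or_ne s 0 with h0 | h0
  · rw [h0] at h1
    have : 0 ≤ 1 / (4 * J) * t ^ 2 := by positivity
    linarith
  have h2 := h.trans (iInf_le _ s)
  rw [legendreRatio, if_neg h0, EReal.le_div_iff_mul_le (by exact_mod_cast (by positivity))
    (EReal.coe_ne_top _)] at h2
  have h3 := h2.trans (hf.legendre_deriv_le t)
  rw [← hs] at h3
  norm_cast at h3
  have h4 : t * s - J * s ^ 2 ≤ 1 / (4 * J) * t ^ 2 := by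
    have : 1 / (4 * J) * t ^ 2 - (t * s - J * s ^ 2) = (t - 2 * J * s) ^ 2 / (4 * J) := by
      field_simp; ring
    have : 0 ≤ (t - 2 * J * s) ^ 2 / (4 * J) := by positivity
    linarith
  linarith

theorem le_legendre_sq (hf : IsConvexSubquadratic f C) (s : ℝ) :
    ((1 / (4 * C) * s ^ 2 : ℝ) : EReal) ≤ legendre f s := by
  refine le_trans (EReal.coe_le_coe_iff.2 ?_) (le_legendre f (s / (2 * C)) s)
  have h1 := hf.le (s / (2 * C))
  have hC := hf.pos
  have : C * (s / (2 * C)) ^ 2 = 1 / (4 * C) * s ^ 2 := by field_simp; ring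
  have : s / (2 * C) * s = 2 * (1 / (4 * C) * s ^ 2) := by field_simp; ring
  linarith

theorem le_iInf_legendreRatio (hf : IsConvexSubquadratic f C) :
    ((1 / (4 * C) : ℝ) : EReal) ≤ ⨅ s, legendreRatio f s := by
  have key : ∀ u : ℝ, u ≠ 0 → ((1 / (4 * C) : ℝ) : EReal) ≤ legendre f u / ((u ^ 2 : ℝ) : EReal) := by
    intro u hu
    rw [EReal.le_div_iff_mul_le (by exact_mod_cast (by positivity)) (EReal.coe_ne_top _)]
    exact_mod_cast hf.le_legendre_sq u
  refine le_iInf fun s => ?_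
  unfold legendreRatio
  split_ifs with hs
  · refine le_liminf_of_le (by isBoundedDefault) ?_
    filter_upwards [self_mem_nhdsWithin] with u hu using key u hu
  · exact key s hs

/-- A point of positive slope nearly realizing the Legendre transform at a positive point. -/
theorem exists_deriv_pos (hf : IsConvexSubquadratic f C) {s r : ℝ} (hs : 0 < s)
    (h : legendre f s / ((s ^ 2 : ℝ) : EReal) < (r : EReal)) :
    ∃ t, 0 < deriv f t ∧ (t * deriv f t - f t) / deriv f t ^ 2 < r := by
  rw [EReal.div_lt_iff (by exact_mod_cast (by positivity)) (EReal.coe_ne_top _)] at h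
  have hL : legendre f s < ((r * s ^ 2 : ℝ) : EReal) := by exact_mod_cast h
  obtain ⟨L, hL1, hL2⟩ : ∃ L : ℝ, (∀ x, x * s - f x ≤ L) ∧ L < r * s ^ 2 := by
    have h1 : legendre f s ≠ ⊥ := by
      intro hb
      have := le_legendre f 0 s
      rw [hb] at this
      exact EReal.coe_ne_bot _ (le_bot_iff.1 this)
    have h2 : legendre f s ≠ ⊤ := (hL.trans (EReal.coe_lt_top _)).ne
    refine ⟨(legendre f s).toReal, fun x => ?_, ?_⟩
    · rw [← EReal.coe_le_coe_iff, EReal.coe_toReal h2 h1]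
      exact le_legendre f x s
    · rw [← EReal.coe_lt_coe_iff, EReal.coe_toReal h2 h1]
      exact hL
  have hL0 : 0 ≤ L := by simpa [hf.map_zero] using hL1 0
  have hr : 0 < r := by
    by_contra! hr
    nlinarith [sq_nonneg s]
  obtain ⟨s₁, hs₁, hs₁s, hLs₁⟩ : ∃ s₁, 0 < s₁ ∧ s₁ < s ∧ L < r * s₁ ^ 2 := by
    have hc : ContinuousAt (fun x : ℝ => r * x ^ 2) s := by fun_prop
    have e1 : ∀ᶠ x in 𝓝[<] s, L < r * x ^ 2 :=
      (hc.tendsto.eventually (lt_mem_nhds hL2)).filter_mono nhdsWithin_le_nhds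
    have e2 : ∀ᶠ x in 𝓝[<] s, 0 < x := (lt_mem_nhds hs).filter_mono nhdsWithin_le_nhds
    obtain ⟨x, hx1, hx2, hx3⟩ := (e1.and (e2.and self_mem_nhdsWithin)).exists
    exact ⟨x, hx2, hx3, hx1⟩
  -- The point s need not be a value of f', for instance at the edge of the domain of the transform;
  -- a slope in (s₁, s] suffices because L < r s₁².
  obtain ⟨t, ht0, ht1, ht2⟩ : ∃ t, 0 ≤ t ∧ s₁ < deriv f t ∧ deriv f t ≤ s := by
    by_cases hbig : ∃ t, 0 ≤ t ∧ s ≤ deriv f t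
    · obtain ⟨t, ht, hst⟩ := hbig
      have := intermediate_value_Icc ht hf.diff_deriv.continuous.continuousOn
      obtain ⟨c, hc, hcs⟩ := this ⟨hf.deriv_zero.trans_le hs.le, hst⟩
      exact ⟨c, hc.1, by rw [hcs]; exact hs₁s, hcs.le⟩
    · push Not at hbig
      by_contra! hcon
      have hle : ∀ t, 0 ≤ t → deriv f t ≤ s₁ := fun t ht => by
        by_contra! h'
        exact absurd (hbig t ht) (hcon t ht h').not_gt
      -- If all slopes on [0, ∞) were at most s₁, this t would give ts - f(t) ≥ L + 1, contradicting
      -- the bound L.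
      set t := (L + 1) / (s - s₁) with ht
      have hpos : 0 < s - s₁ := by linarith
      have ht0 : 0 ≤ t := by positivity
      have h1 := (convex_Ici (0 : ℝ)).image_sub_le_mul_sub_of_deriv_le
        hf.diff.continuous.continuousOn hf.diff.differentiableOn
        (fun x hx => hle x (interior_subset hx)) 0 Set.self_mem_Ici t ht0 ht0
      rw [hf.map_zero] at h1
      have h2 := hL1 t
      have h3 : t * (s - s₁) = L + 1 := by rw [ht]; field_simp
      linarith
  refine ⟨t, hs₁.trans ht1, ?_⟩
  rw [div_lt_iff₀ (pow_pos (hs₁.trans ht1) 2)]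
  have h1 : t * deriv f t ≤ t * s := mul_le_mul_of_nonneg_left ht2 ht0
  have h2 : s₁ ^ 2 ≤ deriv f t ^ 2 := pow_le_pow_left₀ hs₁.le ht1.le 2
  have h3 : r * s₁ ^ 2 ≤ r * deriv f t ^ 2 := mul_le_mul_of_nonneg_left h2 hr.le
  linarith [hL1 t]

theorem exists_deriv_ne_zero_of_legendre (hf : IsConvexSubquadratic f C) {s r : ℝ} (hs : s ≠ 0)
    (h : legendre f s / ((s ^ 2 : ℝ) : EReal) < (r : EReal)) :
    ∃ t, deriv f t ≠ 0 ∧ (t * deriv f t - f t) / deriv f t ^ 2 < r := by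
  rcases lt_or_gt_of_ne hs with hs | hs
  · obtain ⟨t, ht, htr⟩ := hf.reflect.exists_deriv_pos (s := -s) (r := r) (by linarith)
      (by rw [legendre_reflect]; simpa using h)
    rw [deriv_comp_neg] at ht htr
    refine ⟨-t, by linarith, ?_⟩
    convert htr using 2 <;> ring
  · obtain ⟨t, ht, htr⟩ := hf.exists_deriv_pos hs h
    exact ⟨t, ht.ne', htr⟩

theorem exists_deriv_ne_zero (hf : IsConvexSubquadratic f C) {r : ℝ}
    (h : ⨅ s, legendreRatio f s < (r : EReal)) :
    ∃ t, deriv f t ≠ 0 ∧ (t * deriv f t - f t) / deriv f t ^ 2 < r := by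
  obtain ⟨s, hs⟩ := iInf_lt_iff.1 h
  unfold legendreRatio at hs
  split_ifs at hs with h0
  · have := frequently_lt_of_liminf_lt (by isBoundedDefault) hs
    obtain ⟨u, hu, hu0⟩ := (this.and_eventually self_mem_nhdsWithin).exists
    exact hf.exists_deriv_ne_zero_of_legendre hu0 hu
  · exact hf.exists_deriv_ne_zero_of_legendre h0 hs

/-- Testing the supremum defining the transform at the point τu and letting u → 0 replaces f by its
second order expansion. -/
theorem sub_le_legendreRatio_zero (hf : IsConvexSubquadratic f C) (τ : ℝ) :
    ((τ - τ ^ 2 * (deriv (deriv f) 0 / 2) : ℝ) : EReal) ≤ legendreRatio f 0 := by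
  rcases eq_or_ne τ 0 with rfl | hτ
  · have := hf.le_iInf_legendreRatio.trans (iInf_le _ 0)
    refine le_trans ?_ this
    have := hf.pos
    exact EReal.coe_le_coe_iff.2 (by simp; positivity)
  have h1 := tendsto_div_sq_of_deriv_zero hf.diff hf.map_zero hf.deriv_zero
    (hf.diff_deriv 0).hasDerivAt
  have h2 : Tendsto (fun u : ℝ => τ * u) (𝓝[≠] 0) (𝓝[≠] 0) := by
    refine tendsto_nhdsWithin_of_tendsto_nhds_of_eventually_within _ ?_ ?_
    · have : Tendsto (fun u : ℝ => τ * u) (𝓝 0) (𝓝 (τ * 0)) := tendsto_id.const_mul τ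
      rw [mul_zero] at this
      exact this.mono_left nhdsWithin_le_nhds
    · filter_upwards [self_mem_nhdsWithin] with u hu
      exact mul_ne_zero hτ hu
  have h3 : Tendsto (fun u : ℝ => ((τ - τ ^ 2 * (f (τ * u) / (τ * u) ^ 2) : ℝ) : EReal)) (𝓝[≠] 0)
      (𝓝 ((τ - τ ^ 2 * (deriv (deriv f) 0 / 2) : ℝ) : EReal)) :=
    (continuous_coe_real_ereal.tendsto _).comp (((h1.comp h2).const_mul _).const_sub τ)
  rw [legendreRatio, if_pos rfl, ← h3.liminf_eq]
  refine liminf_le_liminf ?_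
  filter_upwards [self_mem_nhdsWithin] with u hu
  have hu : u ≠ 0 := hu
  rw [EReal.le_div_iff_mul_le (by exact_mod_cast (by positivity)) (EReal.coe_ne_top _),
    ← EReal.coe_mul]
  refine le_trans (EReal.coe_le_coe_iff.2 (le_of_eq ?_)) (le_legendre f (τ * u) u)
  field_simp

theorem exists_deriv_pos_of_zero (hf : IsConvexSubquadratic f C) {r : ℝ}
    (h : legendreRatio f 0 < (r : EReal)) :
    ∃ t, 0 < deriv f t ∧ (t * deriv f t - f t) / deriv f t ^ 2 < r := by
  set v := deriv (deriv f) 0 with hv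
  have hle : ∀ τ : ℝ, τ - τ ^ 2 * (v / 2) < r := fun τ => by
    exact_mod_cast (hf.sub_le_legendreRatio_zero τ).trans_lt h
  have hv0 : 0 < v := by
    by_contra! hv0
    have := hle r
    nlinarith [sq_nonneg r]
  -- The choice τ = 1/v optimizes the bound. The same value 1/(2v) is the limit of the quotient for
  -- slopes at t → 0, so small t > 0 works.
  have hr : 1 / (2 * v) < r := by
    convert hle (1 / v) using 1
    field_simp; ring
  have h1 := tendsto_div_sq_of_deriv_zero hf.diff hf.map_zero hf.deriv_zero
    (hf.diff_deriv 0).hasDerivAt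
  have h2 : Tendsto (fun t => deriv f t / t) (𝓝[≠] 0) (𝓝 v) := by
    have := hasDerivAt_iff_tendsto_slope.1 (hf.diff_deriv 0).hasDerivAt
    refine this.congr fun x => ?_
    rw [slope_def_field, hf.deriv_zero, sub_zero, sub_zero]
  have h3 : Tendsto (fun t => (deriv f t / t - f t / t ^ 2) / (deriv f t / t) ^ 2) (𝓝[≠] 0)
      (𝓝 (1 / (2 * v))) := by
    have hlim : 1 / (2 * v) = (v - v / 2) / v ^ 2 := by field_simp; norm_num
    rw [hlim]
    exact (h2.sub h1).div (h2.pow 2) (by positivity)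
  have hle' : 𝓝[>] (0 : ℝ) ≤ 𝓝[≠] 0 := nhdsWithin_mono _ fun x hx => ne_of_gt hx
  obtain ⟨t, ht1, ht2, ht0⟩ := (((h3.mono_left hle').eventually (gt_mem_nhds hr)).and
    (((h2.mono_left hle').eventually (lt_mem_nhds hv0)).and self_mem_nhdsWithin)).exists
  have ht0 : 0 < t := ht0
  have hpos : 0 < deriv f t := by
    have := mul_pos ht2 ht0
    rwa [div_mul_cancel₀ _ ht0.ne'] at this
  refine ⟨t, hpos, ?_⟩
  have hne : deriv f t ≠ 0 := hpos.ne'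
  have hne0 : t ≠ 0 := ht0.ne'
  have heq : (deriv f t / t - f t / t ^ 2) / (deriv f t / t) ^ 2
      = (t * deriv f t - f t) / deriv f t ^ 2 := by field_simp
  rwa [heq] at ht1

theorem exists_deriv_pos_of_minimizer (hf : IsConvexSubquadratic f C) {s r : ℝ} (hs : 0 ≤ s)
    (hmin : ∀ u, legendreRatio f s ≤ legendreRatio f u)
    (h : ⨅ s, legendreRatio f s < (r : EReal)) :
    ∃ t, 0 < deriv f t ∧ (t * deriv f t - f t) / deriv f t ^ 2 < r := by
  have h1 : legendreRatio f s < r := (le_iInf hmin).trans_lt h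
  rcases hs.eq_or_lt with rfl | hs
  · exact hf.exists_deriv_pos_of_zero h1
  · rw [legendreRatio, if_neg hs.ne'] at h1
    exact hf.exists_deriv_pos hs h1

/-- The centred increments grow at most quadratically. -/
theorem exists_increment_le (hf : IsConvexSubquadratic f C) (t : ℝ) :
    ∃ κ, 0 < κ ∧ ∀ b, f (t + b) - f t - b * deriv f t ≤ κ * b ^ 2 := by
  set h : ℝ → ℝ := fun b => f (t + b) - f t - b * deriv f t with hh
  have hder : ∀ b, HasDerivAt h (deriv f (t + b) - deriv f t) b := fun b => by
    have h1 : HasDerivAt (fun b => f (t + b)) (deriv f (t + b)) b := by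
      simpa using (hf.diff (t + b)).hasDerivAt.comp_const_add t b
    have h2 := (h1.sub_const (f t)).sub ((hasDerivAt_id b).mul_const (deriv f t))
    rw [one_mul] at h2
    exact h2
  have hder' : deriv h = fun b => deriv f (t + b) - deriv f t := funext fun b => (hder b).deriv
  have h2 : HasDerivAt (deriv h) (deriv (deriv f) (t + 0)) 0 := by
    rw [hder']
    exact ((hf.diff_deriv (t + 0)).hasDerivAt.comp_const_add t 0).sub_const _
  have h3 := tendsto_div_sq_of_deriv_zero (fun b => (hder b).differentiableAt) (by simp [hh])
    (by simp [hder']) h2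
  set a := deriv (deriv f) (t + 0) / 2
  obtain ⟨d, hd, hnear⟩ : ∃ d > 0, ∀ b, b ≠ 0 → |b| < d → h b / b ^ 2 < a + 1 := by
    have := h3.eventually (gt_mem_nhds (lt_add_one a))
    rw [eventually_nhdsWithin_iff, Metric.eventually_nhds_iff] at this
    obtain ⟨d, hd, H⟩ := this
    exact ⟨d, hd, fun b hb hbd => H (by simpa using hbd) hb⟩
  have hC := hf.pos
  -- The first term serves |b| < d through the second derivative at t; the other two serve |b| ≥ d
  -- through the global bound f ≤ C t².
  set κ := |a + 1| + (2 * C * t ^ 2 + |f t| + |deriv f t| * d) / d ^ 2 + 2 * C with hκ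
  have hκ0 : 0 < κ := by positivity
  refine ⟨κ, hκ0, fun b => ?_⟩
  change h b ≤ κ * b ^ 2
  rcases eq_or_ne b 0 with rfl | hb
  · simp [hh]
  have hb2 : 0 < b ^ 2 := by positivity
  rcases lt_or_ge |b| d with hbd | hbd
  · have h4 := (hnear b hb hbd).le
    rw [div_le_iff₀ hb2] at h4
    refine h4.trans (mul_le_mul_of_nonneg_right ?_ hb2.le)
    have : 0 ≤ (2 * C * t ^ 2 + |f t| + |deriv f t| * d) / d ^ 2 := by positivity
    linarith [le_abs_self (a + 1)]
  · have h5 := hf.le (t + b)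
    have h6 : C * (t + b) ^ 2 ≤ 2 * C * t ^ 2 + 2 * C * b ^ 2 := by nlinarith [sq_nonneg (t - b)]
    have h7 : d ^ 2 ≤ b ^ 2 := by rw [← sq_abs b]; exact pow_le_pow_left₀ hd.le hbd 2
    have h8 : |b| * d ≤ b ^ 2 := by
      rw [← sq_abs b, sq]; exact mul_le_mul_of_nonneg_left hbd (abs_nonneg b)
    have h9 : 2 * C * t ^ 2 + |f t| + |b| * |deriv f t|
        ≤ (2 * C * t ^ 2 + |f t| + |deriv f t| * d) / d ^ 2 * b ^ 2 := by
      rw [div_mul_eq_mul_div, le_div_iff₀ (by positivity)]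
      have e1 : (2 * C * t ^ 2 + |f t|) * d ^ 2 ≤ (2 * C * t ^ 2 + |f t|) * b ^ 2 :=
        mul_le_mul_of_nonneg_left h7 (by positivity)
      have e2 : |deriv f t| * d * (|b| * d) ≤ |deriv f t| * d * b ^ 2 :=
        mul_le_mul_of_nonneg_left h8 (by positivity)
      nlinarith
    have h10 : -(b * deriv f t) ≤ |b| * |deriv f t| := by rw [← abs_mul]; exact neg_le_abs _
    have h11 : 0 ≤ |a + 1| * b ^ 2 := by positivity
    have h12 := neg_le_abs (f t)
    have : κ * b ^ 2 = |a + 1| * b ^ 2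
      + (2 * C * t ^ 2 + |f t| + |deriv f t| * d) / d ^ 2 * b ^ 2 + 2 * C * b ^ 2 := by
      rw [hκ]; ring
    rw [this]
    simp only [hh]
    linarith

end IsConvexSubquadratic

/-- Finite exponential moments make the function analytic, and its second derivative is a variance
under the tilted law, hence nonnegative. -/
theorem IsSubgaussian.isConvexSubquadratic {Ω : Type*} [MeasurableSpace Ω] {ξ : Ω → ℝ}
    {μ : Measure Ω} [IsProbabilityMeasure μ] (h : IsSubgaussian ξ μ) :
    ∃ C, IsConvexSubquadratic (cgf ξ μ) C := by
  obtain ⟨C, hC⟩ := h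
  have hset : ∀ t, t ∈ interior (integrableExpSet ξ μ) := fun t => by
    have : integrableExpSet ξ μ = Set.univ := Set.eq_univ_of_forall fun t => (hC t).1
    rw [this, interior_univ]
    trivial
  have han : ∀ t, AnalyticAt ℝ (cgf ξ μ) t := fun t => analyticAt_cgf (hset t)
  have hd : Differentiable ℝ (cgf ξ μ) := fun t => (han t).differentiableAt
  have hd' : Differentiable ℝ (deriv (cgf ξ μ)) := fun t => (han t).deriv.differentiableAt
  refine ⟨max C 1, hd, hd', cgf_zero, by positivity, fun t => (hC t).2.trans ?_, ?_⟩
  · exact mul_le_mul_of_nonneg_right (le_max_left _ _) (sq_nonneg t)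
  · refine convexOn_univ_of_deriv2_nonneg hd hd' fun t => ?_
    rw [← iteratedDeriv_eq_iterate, iteratedDeriv_two_cgf_eq_integral (hset t)]
    exact div_nonneg (integral_nonneg fun ω => by positivity) mgf_nonneg

end Legendre

/-! ### Tail bounds from subgaussian projections. -/

section SubgaussianVector

variable {Ω : Type*} [MeasurableSpace Ω] {Q : Measure Ω}

/-- Random vectors all of whose projections are subgaussian with a common constant. -/
structure IsSubgaussianVector {V : Type*} [NormedAddCommGroup V] [InnerProductSpace ℝ V]
    (X : Ω → V) (Q : Measure Ω) (K : ℝ) : Prop where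
  aemeasurable : ∀ B, AEMeasurable (fun ω => (inner ℝ (X ω) B : ℝ)) Q
  lintegral_exp_le : ∀ B, ∫⁻ ω, ENNReal.ofReal (Real.exp (inner ℝ (X ω) B)) ∂Q
    ≤ ENNReal.ofReal (Real.exp (K * ‖B‖ ^ 2))

variable {V : Type*} [NormedAddCommGroup V] [InnerProductSpace ℝ V] {X : Ω → V} {K : ℝ}

theorem IsSubgaussianVector.measure_le_inner_le (hX : IsSubgaussianVector X Q K) (hK : 0 < K)
    {B : V} {β a : ℝ} (hβ : 0 < β) (hB : ‖B‖ ^ 2 ≤ β) (ha : 0 ≤ a) :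
    Q {ω | a ≤ inner ℝ (X ω) B} ≤ ENNReal.ofReal (Real.exp (-(a ^ 2 / (4 * K * β)))) := by
  -- Minimizer of the Chernoff exponent K τ² β - τ a.
  set τ := a / (2 * K * β) with hτ
  have hτ0 : 0 ≤ τ := by positivity
  have h1 := mul_meas_ge_le_lintegral₀ (hX.aemeasurable (τ • B)).exp.ennreal_ofReal
    (ENNReal.ofReal (Real.exp (τ * a)))
  have h2 := h1.trans (hX.lintegral_exp_le (τ • B))
  have hsub : {ω | a ≤ inner ℝ (X ω) B} ⊆ {ω | ENNReal.ofReal (Real.exp (τ * a))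
      ≤ ENNReal.ofReal (Real.exp (inner ℝ (X ω) (τ • B)))} := fun ω hω => by
    refine ENNReal.ofReal_le_ofReal (Real.exp_le_exp.2 ?_)
    rw [real_inner_smul_right]
    exact mul_le_mul_of_nonneg_left hω hτ0
  have h3 := (mul_le_mul_right (measure_mono (μ := Q) hsub) (ENNReal.ofReal (Real.exp (τ * a)))).trans h2
  have hpos : ENNReal.ofReal (Real.exp (τ * a)) ≠ 0 := by simp [Real.exp_pos]
  rw [mul_comm, ← ENNReal.le_div_iff_mul_le (Or.inl hpos) (Or.inl ENNReal.ofReal_ne_top),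
    ← ENNReal.ofReal_div_of_pos (Real.exp_pos _), ← Real.exp_sub] at h3
  refine h3.trans (ENNReal.ofReal_le_ofReal (Real.exp_le_exp.2 ?_))
  have h4 : ‖τ • B‖ ^ 2 ≤ τ ^ 2 * β := by
    rw [norm_smul, mul_pow, Real.norm_eq_abs, sq_abs]
    exact mul_le_mul_of_nonneg_left hB (sq_nonneg _)
  have h5 : K * ‖τ • B‖ ^ 2 ≤ K * (τ ^ 2 * β) := mul_le_mul_of_nonneg_left h4 hK.le
  have h6 : K * (τ ^ 2 * β) - τ * a = -(a ^ 2 / (4 * K * β)) := by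
    rw [hτ]; field_simp; ring
  linarith

/-- Tail bound for the leading part of a random matrix with subgaussian projections. -/
theorem IsSubgaussianVector.exists_exceptional_set {n k : ℕ}
    {X : Ω → EuclideanSpace ℝ (Fin n × Fin n)} (hX : IsSubgaussianVector X Q K) (hK : 0 < K)
    (hk : 1 ≤ k) {ε : ℝ} (hε : 0 < ε) (hε1 : 2 * k * ε ≤ 1) {ρ : ℝ} (hρ : 0 ≤ ρ) :
    ∃ S : Set Ω, NullMeasurableSet S Q ∧
      Q S ≤ ENNReal.ofReal ((1 + 2 / ε) ^ (2 * k * n)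
        * Real.exp (-(((1 - 2 * k * ε) * ρ) ^ 2 / (4 * K * (1 + 2 * k * ε) ^ 2)))) ∧
      ∀ ω ∉ S, ∀ u w : Fin k → EuclideanSpace ℝ (Fin n), (∀ i, ‖u i‖ ≤ 1) →
        (∀ i, ‖w i‖ ≤ 1) → ‖rankSum u w‖ ≤ 1 → inner ℝ (X ω) (rankSum u w) < ρ := by
  obtain ⟨N, hcard, hnorm, hnet⟩ := exists_net_pairing hk n hε hε1
  refine ⟨⋃ B ∈ N, {ω | (1 - 2 * k * ε) * ρ ≤ inner ℝ (X ω) B}, ?_, ?_, ?_⟩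
  · exact Finset.nullMeasurableSet_biUnion _ fun B _ =>
      nullMeasurableSet_le aemeasurable_const (hX.aemeasurable B)
  · refine (measure_biUnion_finset_le _ _).trans ?_
    refine (Finset.sum_le_card_nsmul _ _ _ fun B hB => hX.measure_le_inner_le hK
      (β := (1 + 2 * k * ε) ^ 2) (by positivity)
      (pow_le_pow_left₀ (norm_nonneg _) (hnorm B hB) 2)
      (mul_nonneg (by linarith) hρ)).trans ?_
    rw [nsmul_eq_mul, ← ENNReal.ofReal_natCast, ← ENNReal.ofReal_mul (Nat.cast_nonneg _)]
    exact ENNReal.ofReal_le_ofReal (mul_le_mul_of_nonneg_right hcard (Real.exp_pos _).le)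
  · intro ω hω u w hu hw hB
    by_contra! hle
    obtain ⟨B, hBN, hBle⟩ := hnet (X ω) ρ u w hρ hu hw hB hle
    exact hω (Set.mem_biUnion hBN hBle)

end SubgaussianVector

/-! ### Exponential tilting of the independent entries. -/

section Tilt

variable {n : ℕ}

/-- The index set of the entries above the diagonal. -/
abbrev UpperPair (n : ℕ) : Type := {p : Fin n × Fin n // p.1 < p.2}

theorem sum_eq_sum_upperPair (F : Fin n × Fin n → ℝ) (hF : ∀ i, F (i, i) = 0) :
    ∑ p, F p = ∑ q : UpperPair n, (F q.1 + F q.1.swap) := by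
  have h1 : ∑ p, F p = ∑ p, ((if p.1 < p.2 then F p else 0) + (if p.2 < p.1 then F p else 0)) := by
    refine Finset.sum_congr rfl fun p _ => ?_
    rcases lt_trichotomy p.1 p.2 with h | h | h
    · simp [h, h.not_gt]
    · have : p = (p.1, p.1) := Prod.ext rfl h.symm
      rw [this, hF]; simp
    · simp [h, h.not_gt]
  have h2 : ∑ p : Fin n × Fin n, (if p.2 < p.1 then F p else 0)
      = ∑ p : Fin n × Fin n, (if p.1 < p.2 then F p.swap else 0) := by
    rw [← (Equiv.prodComm (Fin n) (Fin n)).sum_comp]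
    rfl
  rw [h1, Finset.sum_add_distrib, h2, ← Finset.sum_add_distrib]
  have h3 : ∀ p : Fin n × Fin n, ((if p.1 < p.2 then F p else 0)
      + (if p.1 < p.2 then F p.swap else 0)) = if p.1 < p.2 then F p + F p.swap else 0 := by
    intro p; split_ifs <;> simp
  simp_rw [h3]
  rw [← Finset.sum_filter]
  exact Finset.sum_subtype _ (by simp) _

/-- By symmetry the coefficient of an entry is a sum of two entries of B. The resulting factor 2 is
the origin of the 1/2 in the rate function. -/
theorem sum_upperPair_sq_le (B : EuclideanSpace ℝ (Fin n × Fin n)) :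
    ∑ q : UpperPair n, (B q.1 + B q.1.swap) ^ 2 ≤ 2 * ‖B‖ ^ 2 := by
  have h1 := sum_eq_sum_upperPair (fun p : Fin n × Fin n => if p.1 = p.2 then 0 else B p ^ 2)
    (by simp)
  have h2 : ∑ p : Fin n × Fin n, (if p.1 = p.2 then 0 else B p ^ 2) ≤ ‖B‖ ^ 2 := by
    rw [EuclideanSpace.real_norm_sq_eq]
    refine Finset.sum_le_sum fun p _ => ?_
    split_ifs
    · positivity
    · exact le_rfl
  rw [h1] at h2
  refine le_trans ?_ (mul_le_mul_of_nonneg_left h2 zero_le_two)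
  rw [Finset.mul_sum]
  refine Finset.sum_le_sum fun q _ => ?_
  have := q.2.ne
  simp only [this, this.symm, Prod.fst_swap, Prod.snd_swap, if_false]
  nlinarith [sq_nonneg (B q.1 - B q.1.swap)]

variable {Ω Ω' : Type*} [MeasurableSpace Ω] [MeasurableSpace Ω'] {μ : Measure Ω'}
  [IsProbabilityMeasure μ] {ξ : Ω' → ℝ} {P : Measure Ω} [IsProbabilityMeasure P]
  {A : Ω → Matrix (Fin n) (Fin n) ℝ}

/-- A linear form in the entries above the diagonal. -/
def upperForm (A : Ω → Matrix (Fin n) (Fin n) ℝ) (θ : UpperPair n → ℝ) (ω : Ω) : ℝ :=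
  ∑ q, θ q * A ω q.1.1 q.1.2

namespace IsSymmIIDMatrix

theorem aemeasurable_entry (hA : IsSymmIIDMatrix A P ξ μ) (q : UpperPair n) :
    AEMeasurable (fun ω => A ω q.1.1 q.1.2) P :=
  (hA.identDistrib _ _ q.2).aemeasurable_fst

theorem aemeasurable_upperForm (hA : IsSymmIIDMatrix A P ξ μ) (θ : UpperPair n → ℝ) :
    AEMeasurable (upperForm A θ) P :=
  Finset.aemeasurable_fun_sum _ fun q _ => (hA.aemeasurable_entry q).const_mul _

theorem integral_exp_upperForm (hA : IsSymmIIDMatrix A P ξ μ)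
    (hint : ∀ t, Integrable (fun ω => Real.exp (t * ξ ω)) μ) (θ : UpperPair n → ℝ) :
    ∫ ω, Real.exp (upperForm A θ ω) ∂P = Real.exp (∑ q, cgf ξ μ (θ q)) := by
  have hind : iIndepFun (fun (q : UpperPair n) ω => θ q * A ω q.1.1 q.1.2) P :=
    hA.iIndep.comp (fun q x => θ q * x) fun q => measurable_const_mul _
  have h1 := hind.mgf_sum₀ (t := 1) (fun q => (hA.aemeasurable_entry q).const_mul _) Finset.univ
  have h2 : mgf (∑ q : UpperPair n, fun ω => θ q * A ω q.1.1 q.1.2) P 1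
      = ∫ ω, Real.exp (upperForm A θ ω) ∂P := by
    simp [mgf, upperForm]
  rw [← h2, h1, Real.exp_sum]
  refine Finset.prod_congr rfl fun q _ => ?_
  rw [mgf_const_mul, mul_one, mgf_congr_identDistrib (hA.identDistrib _ _ q.2), exp_cgf (hint _)]

theorem integrable_exp_upperForm (hA : IsSymmIIDMatrix A P ξ μ)
    (hint : ∀ t, Integrable (fun ω => Real.exp (t * ξ ω)) μ) (θ : UpperPair n → ℝ) :
    Integrable (fun ω => Real.exp (upperForm A θ ω)) P := by
  by_contra h
  have := hA.integral_exp_upperForm hint θ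
  rw [integral_undef h] at this
  exact (Real.exp_pos _).ne this

theorem inner_entryVec_sub (hA : IsSymmIIDMatrix A P ξ μ) {M : Matrix (Fin n) (Fin n) ℝ}
    (hM : M.IsHermitian) (hM0 : ∀ i, M i i = 0) (B : EuclideanSpace ℝ (Fin n × Fin n)) (ω : Ω) :
    inner ℝ (entryVec (A ω - M)) B = upperForm A (fun q => B q.1 + B q.1.swap) ω
      - ∑ q : UpperPair n, (B q.1 + B q.1.swap) * M q.1.1 q.1.2 := by
  rw [inner_entryVec, sum_eq_sum_upperPair _ (by simp [hA.diag_eq_zero, hM0]), upperForm,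
    ← Finset.sum_sub_distrib]
  refine Finset.sum_congr rfl fun q _ => ?_
  have h1 : A ω q.1.2 q.1.1 = A ω q.1.1 q.1.2 := by
    simpa using (hA.isHermitian ω).apply q.1.1 q.1.2
  have h2 : M q.1.2 q.1.1 = M q.1.1 q.1.2 := by simpa using hM.apply q.1.1 q.1.2
  simp only [Matrix.sub_apply, Prod.fst_swap, Prod.snd_swap, h1, h2]
  ring

/-- Under an exponential tilt, the centred matrix has subgaussian projections. -/
theorem isSubgaussianVector_tilted (hA : IsSymmIIDMatrix A P ξ μ)
    (hint : ∀ t, Integrable (fun ω => Real.exp (t * ξ ω)) μ) (θ : UpperPair n → ℝ)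
    {M : Matrix (Fin n) (Fin n) ℝ} (hM : M.IsHermitian) (hM0 : ∀ i, M i i = 0) {κ : ℝ} (hκ : 0 ≤ κ)
    (h : ∀ (q : UpperPair n) (b : ℝ), cgf ξ μ (θ q + b) - cgf ξ μ (θ q) - b * M q.1.1 q.1.2
      ≤ κ * b ^ 2) :
    IsSubgaussianVector (fun ω => entryVec (A ω - M)) (P.tilted (upperForm A θ)) (2 * κ) := by
  constructor
  · intro B
    simp only [hA.inner_entryVec_sub hM hM0 B]
    exact ((hA.aemeasurable_upperForm _).sub_const _).mono_ac (tilted_absolutelyContinuous _ _)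
  intro B
  set b : UpperPair n → ℝ := fun q => B q.1 + B q.1.swap with hb
  simp only [hA.inner_entryVec_sub hM hM0 B]
  rw [lintegral_tilted, hA.integral_exp_upperForm hint]
  have h1 : ∀ ω, ENNReal.ofReal (Real.exp (upperForm A θ ω) / Real.exp (∑ q, cgf ξ μ (θ q)))
      * ENNReal.ofReal (Real.exp (upperForm A b ω - ∑ q, b q * M q.1.1 q.1.2))
      = ENNReal.ofReal (Real.exp (upperForm A (θ + b) ω)
        * Real.exp (-(∑ q, cgf ξ μ (θ q)) - ∑ q, b q * M q.1.1 q.1.2)) := fun ω => by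
    rw [← ENNReal.ofReal_mul (by positivity), ← Real.exp_sub, ← Real.exp_add, ← Real.exp_add]
    congr 2
    have : upperForm A (θ + b) ω = upperForm A θ ω + upperForm A b ω := by
      simp [upperForm, add_mul, Finset.sum_add_distrib]
    rw [this]; ring
  rw [lintegral_congr h1, ← ofReal_integral_eq_lintegral_ofReal
    ((hA.integrable_exp_upperForm hint _).mul_const _) (ae_of_all _ fun ω => by positivity),
    integral_mul_const, hA.integral_exp_upperForm hint, ← Real.exp_add]
  refine ENNReal.ofReal_le_ofReal (Real.exp_le_exp.2 ?_)
  -- By independence the logarithm of the exponential moment is this sum of centred increments of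
  -- the cumulant-generating function.
  have h2 : ∑ q : UpperPair n, (cgf ξ μ ((θ + b) q) - cgf ξ μ (θ q) - b q * M q.1.1 q.1.2)
      ≤ ∑ q : UpperPair n, κ * b q ^ 2 := Finset.sum_le_sum fun q _ => h q (b q)
  rw [← Finset.mul_sum, Finset.sum_sub_distrib, Finset.sum_sub_distrib] at h2
  have h3 := mul_le_mul_of_nonneg_left (sum_upperPair_sq_le B) hκ
  linarith

/-- Lower bound for a probability in terms of an exponentially tilted one. -/
theorem le_measure_of_tilted (hA : IsSymmIIDMatrix A P ξ μ)
    (hint : ∀ t, Integrable (fun ω => Real.exp (t * ξ ω)) μ) (θ : UpperPair n → ℝ) {S : Set Ω}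
    (hS : NullMeasurableSet S P) {a c : ℝ} (ha : ∀ ω ∈ S, upperForm A θ ω ≤ a)
    (hc : ENNReal.ofReal c ≤ P.tilted (upperForm A θ) S) :
    ENNReal.ofReal (c * Real.exp (∑ q, cgf ξ μ (θ q) - a)) ≤ P S := by
  rw [tilted_apply, hA.integral_exp_upperForm hint] at hc
  have h1 : ∫⁻ ω in S, ENNReal.ofReal (Real.exp (upperForm A θ ω)
      / Real.exp (∑ q, cgf ξ μ (θ q))) ∂P
      ≤ ∫⁻ ω in S, ENNReal.ofReal (Real.exp (a - ∑ q, cgf ξ μ (θ q))) ∂P := by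
    refine lintegral_mono_ae ((ae_restrict_iff'₀ hS).2 (ae_of_all _ fun ω hω => ?_))
    rw [← Real.exp_sub]
    exact ENNReal.ofReal_le_ofReal (Real.exp_le_exp.2 (by linarith [ha ω hω]))
  rw [setLIntegral_const] at h1
  have h2 := hc.trans h1
  have h3 : Real.exp (∑ q, cgf ξ μ (θ q) - a) = (Real.exp (a - ∑ q, cgf ξ μ (θ q)))⁻¹ := by
    rw [← Real.exp_neg]; congr 1; ring
  rw [h3, ← div_eq_mul_inv, ENNReal.ofReal_div_of_pos (Real.exp_pos _)]
  exact ENNReal.div_le_of_le_mul' h2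

end IsSymmIIDMatrix

end Tilt

/-! ### Block matrices and their spectral form. -/

section Blocks

variable {n k : ℕ}

theorem exists_disjoint_blocks (l : Fin k → ℕ) (h : ∑ j, l j ≤ n) :
    ∃ I : Fin k → Finset (Fin n), (∀ i j, i ≠ j → Disjoint (I i) (I j)) ∧
      ∀ j, (I j).card = l j := by
  have hcard : Fintype.card (Σ j : Fin k, Fin (l j)) ≤ Fintype.card (Fin n) := by simpa using h
  obtain ⟨g⟩ := Function.Embedding.nonempty_of_card_le hcard
  refine ⟨fun j => Finset.univ.map ((Function.Embedding.sigmaMk j).trans g), ?_, by simp⟩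
  intro i j hij
  rw [Finset.disjoint_left]
  intro p hp hp'
  simp only [Finset.mem_map, Finset.mem_univ, true_and, Function.Embedding.trans_apply,
    Function.Embedding.sigmaMk_apply] at hp hp'
  obtain ⟨a, rfl⟩ := hp
  obtain ⟨b, hb⟩ := hp'
  exact hij (congrArg Sigma.fst (g.injective hb)).symm

/-- The indicator of the pairs of indices lying in a common block. -/
def blockInd (I : Fin k → Finset (Fin n)) (p q : Fin n) : ℝ :=
  ∑ j, if p ∈ I j ∧ q ∈ I j then 1 else 0

/-- The block matrix with zero diagonal and all other entries of the diagonal blocks equal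
to `s`. -/
def blockMatrix (I : Fin k → Finset (Fin n)) (s : ℝ) : Matrix (Fin n) (Fin n) ℝ :=
  fun p q => if p = q then 0 else s * blockInd I p q

/-- The normalized indicator vectors of the blocks. -/
noncomputable def blockVec (I : Fin k → Finset (Fin n)) (j : Fin k) : EuclideanSpace ℝ (Fin n) :=
  WithLp.toLp 2 fun p => if p ∈ I j then (√((I j).card : ℝ))⁻¹ else 0

variable {I : Fin k → Finset (Fin n)}

theorem blockInd_comm (I : Fin k → Finset (Fin n)) (p q : Fin n) :
    blockInd I p q = blockInd I q p := by
  simp only [blockInd, and_comm]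

theorem blockInd_eq_zero_or_one (hI : ∀ i j, i ≠ j → Disjoint (I i) (I j)) (p q : Fin n) :
    blockInd I p q = 0 ∨ blockInd I p q = 1 := by
  by_cases h : ∃ j, p ∈ I j ∧ q ∈ I j
  · obtain ⟨j, hj⟩ := h
    right
    rw [blockInd, Finset.sum_eq_single j, if_pos hj]
    · intro i _ hij
      rw [if_neg]
      exact fun h' => Finset.disjoint_left.1 (hI i j hij) h'.1 hj.1
    · simp
  · push Not at h
    left
    exact Finset.sum_eq_zero fun j _ => if_neg fun h' => h j h'.1 h'.2

theorem blockMatrix_isHermitian (I : Fin k → Finset (Fin n)) (s : ℝ) :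
    (blockMatrix I s).IsHermitian := by
  refine Matrix.IsHermitian.ext fun p q => ?_
  simp only [blockMatrix, blockInd_comm I q p, eq_comm (a := q), star_trivial]

theorem orthonormal_blockVec (hI : ∀ i j, i ≠ j → Disjoint (I i) (I j))
    (hpos : ∀ j, 0 < (I j).card) : Orthonormal ℝ (blockVec I) := by
  rw [orthonormal_iff_ite]
  intro i j
  have hin : (inner ℝ (blockVec I i) (blockVec I j) : ℝ) = ∑ p,
      (if p ∈ I i then (√((I i).card : ℝ))⁻¹ else 0)
        * (if p ∈ I j then (√((I j).card : ℝ))⁻¹ else 0) := by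
    simp [PiLp.inner_apply, blockVec, mul_comm]
  rw [hin]
  split_ifs with hij
  · subst hij
    have hc : (0 : ℝ) < (I i).card := by exact_mod_cast hpos i
    have : ∀ p : Fin n, (if p ∈ I i then (√((I i).card : ℝ))⁻¹ else 0)
        * (if p ∈ I i then (√((I i).card : ℝ))⁻¹ else 0)
        = if p ∈ I i then ((I i).card : ℝ)⁻¹ else 0 := fun p => by
      split_ifs
      · rw [← mul_inv, Real.mul_self_sqrt hc.le]
      · simp
    simp_rw [this]
    rw [Finset.sum_ite_mem, Finset.univ_inter, Finset.sum_const, nsmul_eq_mul,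
      mul_inv_cancel₀ hc.ne']
  · refine Finset.sum_eq_zero fun p _ => ?_
    by_cases h : p ∈ I i
    · rw [if_neg (Finset.disjoint_left.1 (hI i j hij) h), mul_zero]
    · rw [if_neg h, zero_mul]

theorem spectralSum_blockVec_apply (hpos : ∀ j, 0 < (I j).card) (s : ℝ)
    (v : EuclideanSpace ℝ (Fin n)) (p : Fin n) :
    spectralSum (blockVec I) (fun j => s * (I j).card) v p = ∑ q, s * blockInd I p q * v q := by
  have h1 : ∀ j, (s * (I j).card * inner ℝ (blockVec I j) v) * blockVec I j p
      = ∑ q, s * (if p ∈ I j ∧ q ∈ I j then 1 else 0) * v q := fun j => by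
    have hc : (0 : ℝ) < (I j).card := by exact_mod_cast hpos j
    simp only [PiLp.inner_apply, blockVec, Finset.mul_sum, Finset.sum_mul]
    refine Finset.sum_congr rfl fun q _ => ?_
    have hs : √((I j).card : ℝ) ≠ 0 := (Real.sqrt_pos.2 hc).ne'
    have hs2 : ((I j).card : ℝ) * ((√((I j).card : ℝ))⁻¹ * (√((I j).card : ℝ))⁻¹) = 1 := by
      rw [← mul_inv, Real.mul_self_sqrt hc.le, mul_inv_cancel₀ hc.ne']
    by_cases hp : p ∈ I j <;> by_cases hq : q ∈ I j <;> simp [hp, hq]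
    linear_combination (s * v q) * hs2
  have h2 : spectralSum (blockVec I) (fun j => s * (I j).card) v p
      = ∑ j, (s * (I j).card * inner ℝ (blockVec I j) v) * blockVec I j p := by
    simp [spectralSum]
  rw [h2, Finset.sum_congr rfl fun j _ => h1 j, Finset.sum_comm]
  refine Finset.sum_congr rfl fun q _ => ?_
  rw [blockInd, Finset.mul_sum, Finset.sum_mul]

/-- The two operators differ only by the diagonal, which was set to zero and has entries 0 or s in
the spectral sum. -/
theorem norm_blockMatrix_sub_spectralSum_le (hI : ∀ i j, i ≠ j → Disjoint (I i) (I j))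
    (hpos : ∀ j, 0 < (I j).card) (s : ℝ) (v : EuclideanSpace ℝ (Fin n)) :
    ‖Matrix.toEuclideanLin (blockMatrix I s) v
      - spectralSum (blockVec I) (fun j => s * (I j).card) v‖ ≤ |s| * ‖v‖ := by
  refine le_of_sq_le_sq ?_ (by positivity)
  rw [mul_pow, sq_abs, EuclideanSpace.real_norm_sq_eq, EuclideanSpace.real_norm_sq_eq,
    Finset.mul_sum]
  refine Finset.sum_le_sum fun p _ => ?_
  have h1 : (Matrix.toEuclideanLin (blockMatrix I s) v
      - spectralSum (blockVec I) (fun j => s * (I j).card) v) p = -(s * blockInd I p p * v p) := by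
    rw [PiLp.sub_apply, spectralSum_blockVec_apply hpos]
    simp only [Matrix.toLpLin_apply, Matrix.mulVec, dotProduct]
    rw [← Finset.sum_sub_distrib, Finset.sum_eq_single p]
    · simp [blockMatrix]
    · intro q _ hq
      simp [blockMatrix, hq.symm]
    · simp
  rw [h1]
  rcases blockInd_eq_zero_or_one hI p p with h | h <;> rw [h]
  · simp only [mul_zero, zero_mul, neg_zero, ne_eq, OfNat.ofNat_ne_zero, not_false_eq_true,
      zero_pow]
    positivity
  · exact le_of_eq (by ring)

theorem sum_upperPair_blockInd_le (I : Fin k → Finset (Fin n)) :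
    ∑ q : UpperPair n, blockInd I q.1.1 q.1.2 ≤ (∑ j, ((I j).card : ℝ) ^ 2) / 2 := by
  have h0 : ∀ p q, 0 ≤ blockInd I p q := fun p q =>
    Finset.sum_nonneg fun j _ => by split_ifs <;> norm_num
  have h1 := sum_eq_sum_upperPair
    (fun p : Fin n × Fin n => if p.1 = p.2 then 0 else blockInd I p.1 p.2) (by simp)
  have h2 : ∑ q : UpperPair n, ((if q.1.1 = q.1.2 then 0 else blockInd I q.1.1 q.1.2)
      + (if q.1.swap.1 = q.1.swap.2 then 0 else blockInd I q.1.swap.1 q.1.swap.2))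
      = 2 * ∑ q : UpperPair n, blockInd I q.1.1 q.1.2 := by
    rw [Finset.mul_sum]
    refine Finset.sum_congr rfl fun q _ => ?_
    have := q.2.ne
    simp only [this, this.symm, Prod.fst_swap, Prod.snd_swap, if_false, blockInd_comm I q.1.2 q.1.1]
    ring
  have h3 : ∑ p : Fin n × Fin n, (if p.1 = p.2 then 0 else blockInd I p.1 p.2)
      ≤ ∑ p : Fin n × Fin n, blockInd I p.1 p.2 :=
    Finset.sum_le_sum fun p _ => by split_ifs; exacts [h0 _ _, le_rfl]
  have h4 : ∑ p : Fin n × Fin n, blockInd I p.1 p.2 = ∑ j, ((I j).card : ℝ) ^ 2 := by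
    simp only [blockInd]
    rw [Finset.sum_comm]
    refine Finset.sum_congr rfl fun j _ => ?_
    have : (Finset.univ.filter fun p : Fin n × Fin n => p.1 ∈ I j ∧ p.2 ∈ I j) = I j ×ˢ I j := by
      ext p; simp
    rw [← Finset.sum_filter, this]
    simp [sq]
  rw [h2] at h1
  linarith

end Blocks

/-! ### Probability of being close to a block matrix. -/

section BlockEvent

variable {n k : ℕ} {Ω Ω' : Type*} [MeasurableSpace Ω] [MeasurableSpace Ω'] {μ : Measure Ω'}
  [IsProbabilityMeasure μ] {ξ : Ω' → ℝ} {P : Measure Ω} [IsProbabilityMeasure P]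
  {A : Ω → Matrix (Fin n) (Fin n) ℝ}

theorem norm_toEuclideanLin_le_of_inner_lt (D : Matrix (Fin n) (Fin n) ℝ) {ρ : ℝ}
    (h : ∀ u w : Fin 1 → EuclideanSpace ℝ (Fin n), (∀ i, ‖u i‖ ≤ 1) →
        (∀ i, ‖w i‖ ≤ 1) → ‖rankSum u w‖ ≤ 1 → inner ℝ (entryVec D) (rankSum u w) < ρ)
    (v : EuclideanSpace ℝ (Fin n)) : ‖Matrix.toEuclideanLin D v‖ ≤ ρ * ‖v‖ := by
  have h1 : ∀ w u : EuclideanSpace ℝ (Fin n), ‖w‖ = 1 → ‖u‖ = 1 →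
      inner ℝ (entryVec D) (outerVec w u) ≤ ρ := fun w u hw hu => by
    have := h (fun _ => u) (fun _ => w) (fun _ => hu.le) (fun _ => hw.le)
      (by simp [rankSum, norm_outerVec, hu, hw])
    simpa [rankSum] using this.le
  have h2 := inner_outerVec_le_of_unit h1 (Matrix.toEuclideanLin D v) v
  rw [inner_entryVec_outerVec, real_inner_self_eq_norm_sq] at h2
  rcases (norm_nonneg (Matrix.toEuclideanLin D v)).eq_or_lt with h0 | h0
  · rw [← h0]
    have := h (fun _ => 0) (fun _ => 0) (by simp) (by simp)
      (by simp [rankSum, norm_outerVec])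
    have hz : rankSum (fun _ : Fin 1 => (0 : EuclideanSpace ℝ (Fin n))) (fun _ => 0) = 0 := by
      simp [rankSum, ← norm_eq_zero, norm_outerVec]
    rw [hz, inner_zero_right] at this
    positivity
  · refine le_of_mul_le_mul_left ?_ h0
    linarith

/-- The event that the matrix is close to a block matrix. -/
theorem IsSymmIIDMatrix.exists_block_event (hA : IsSymmIIDMatrix A P ξ μ)
    (hint : ∀ t, Integrable (fun ω => Real.exp (t * ξ ω)) μ) {t κ : ℝ} (hκ : 0 < κ)
    (hderiv0 : deriv (cgf ξ μ) 0 = 0)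
    (hconv : 0 ≤ t * deriv (cgf ξ μ) t - cgf ξ μ t)
    (h0 : ∀ b, cgf ξ μ (0 + b) - cgf ξ μ 0 - b * deriv (cgf ξ μ) 0 ≤ κ * b ^ 2)
    (ht : ∀ b, cgf ξ μ (t + b) - cgf ξ μ t - b * deriv (cgf ξ μ) t ≤ κ * b ^ 2)
    {l : Fin k → ℕ} (hl : ∀ j, 0 < l j) (hln : ∑ j, l j ≤ n) {ρ a β : ℝ} (hρ : 0 ≤ ρ)
    (ha : 0 ≤ a) (hβ : 0 < β) (hβl : t ^ 2 * ((∑ j, (l j : ℝ) ^ 2) / 2) ≤ β)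
    (hB1 : (9 : ℝ) ^ (2 * n) * Real.exp (-(ρ ^ 2 / (72 * κ))) ≤ 1 / 4)
    (hB2 : Real.exp (-(a ^ 2 / (8 * κ * β))) ≤ 1 / 4) :
    ∃ S : Set Ω, ENNReal.ofReal (1 / 2 * Real.exp (-((∑ j, (l j : ℝ) ^ 2) / 2
        * (t * deriv (cgf ξ μ) t - cgf ξ μ t) + a))) ≤ P S ∧
      ∀ ω ∈ S, ∃ e : Fin k → EuclideanSpace ℝ (Fin n), Orthonormal ℝ e ∧
        ∀ v, ‖Matrix.toEuclideanLin (A ω) v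
          - spectralSum e (fun j => deriv (cgf ξ μ) t * l j) v‖
          ≤ (ρ + |deriv (cgf ξ μ) t|) * ‖v‖ := by
  set s := deriv (cgf ξ μ) t with hs
  obtain ⟨I, hI, hIl⟩ := exists_disjoint_blocks l hln
  have hpos : ∀ j, 0 < (I j).card := fun j => by rw [hIl]; exact hl j
  set θ : UpperPair n → ℝ := fun q => t * blockInd I q.1.1 q.1.2 with hθ
  set M := blockMatrix I s with hM
  have hMq : ∀ q : UpperPair n, M q.1.1 q.1.2 = s * blockInd I q.1.1 q.1.2 := fun q =>
    if_neg q.2.ne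
  have hM0 : ∀ i, M i i = 0 := fun i => if_pos rfl
  have hMh : M.IsHermitian := blockMatrix_isHermitian I s
  set Q := P.tilted (upperForm A θ) with hQ
  have hQprob : IsProbabilityMeasure Q :=
    isProbabilityMeasure_tilted (hA.integrable_exp_upperForm hint θ)
  have hX : IsSubgaussianVector (fun ω => entryVec (A ω - M)) Q (2 * κ) := by
    refine hA.isSubgaussianVector_tilted hint θ hMh hM0 hκ.le fun q b => ?_
    rw [hMq]
    simp only [hθ]
    rcases blockInd_eq_zero_or_one hI q.1.1 q.1.2 with h | h <;> rw [h]
    · have := h0 b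
      rw [hderiv0] at this
      simpa using this
    · simpa using ht b
  set N := ∑ q : UpperPair n, blockInd I q.1.1 q.1.2 with hN
  have hNle : N ≤ (∑ j, (l j : ℝ) ^ 2) / 2 := by
    have := sum_upperPair_blockInd_le I
    simpa only [hIl] using this
  -- Pairing with this strictly upper triangular matrix gives the tilting form centred by N t s,
  -- where N counts the upper pairs in a common block; concentration of this form controls the
  -- likelihood ratio.
  set B₀ : EuclideanSpace ℝ (Fin n × Fin n) :=
    WithLp.toLp 2 fun p => if p.1 < p.2 then t * blockInd I p.1 p.2 else 0 with hB₀
  have hBq : ∀ q : UpperPair n, B₀ q.1 + B₀ q.1.swap = θ q := fun q => by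
    have h1 := q.2
    simp [hB₀, hθ, h1, h1.not_gt]
  have hinner : ∀ ω, inner ℝ (entryVec (A ω - M)) B₀ = upperForm A θ ω - N * (t * s) := fun ω => by
    rw [hA.inner_entryVec_sub hMh hM0]
    simp only [hBq, hMq]
    congr 1
    rw [hN, Finset.sum_mul]
    refine Finset.sum_congr rfl fun q _ => ?_
    rcases blockInd_eq_zero_or_one hI q.1.1 q.1.2 with h | h <;> simp [hθ, h]
  have hBnorm : ‖B₀‖ ^ 2 ≤ β := by
    have h1 : ‖B₀‖ ^ 2 = t ^ 2 * N := by
      rw [EuclideanSpace.real_norm_sq_eq, sum_eq_sum_upperPair _ (by simp [hB₀]), hN,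
        Finset.mul_sum]
      refine Finset.sum_congr rfl fun q _ => ?_
      have h1 := q.2
      rcases blockInd_eq_zero_or_one hI q.1.1 q.1.2 with h | h <;>
        simp [hB₀, h1, h1.not_gt, h]
    rw [h1]
    exact (mul_le_mul_of_nonneg_left hNle (sq_nonneg t)).trans hβl
  have hcgf : ∑ q, cgf ξ μ (θ q) = N * cgf ξ μ t := by
    rw [hN, Finset.sum_mul]
    refine Finset.sum_congr rfl fun q _ => ?_
    rcases blockInd_eq_zero_or_one hI q.1.1 q.1.2 with h | h <;> simp [hθ, h]
  -- The rank one case bounds the operator norm of the noise. With ε = 1/4 the net has at most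
  -- 9^(2n) points and the exponent is ρ²/(72κ).
  obtain ⟨S₁, hS₁m, hS₁Q, hS₁⟩ := hX.exists_exceptional_set (by positivity) le_rfl
    (ε := 1 / 4) (by norm_num) (by norm_num) hρ
  set S₂ := {ω | a ≤ inner ℝ (entryVec (A ω - M)) B₀} with hS₂
  have hS₂Q : Q S₂ ≤ ENNReal.ofReal (1 / 4) := by
    refine (hX.measure_le_inner_le (by positivity) hβ hBnorm ha).trans
      (ENNReal.ofReal_le_ofReal ?_)
    convert hB2 using 4
    ring
  have hS₁Q' : Q S₁ ≤ ENNReal.ofReal (1 / 4) := by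
    refine hS₁Q.trans (ENNReal.ofReal_le_ofReal ?_)
    convert hB1 using 2
    · norm_num
    · congr 2
      norm_num
      field_simp
      ring
  have hS₂m : NullMeasurableSet S₂ Q := nullMeasurableSet_le aemeasurable_const (hX.aemeasurable B₀)
  have hm : NullMeasurableSet (S₁ ∪ S₂)ᶜ Q := (hS₁m.union hS₂m).compl
  refine ⟨(S₁ ∪ S₂)ᶜ, ?_, ?_⟩
  · have hc : ENNReal.ofReal (1 / 2) ≤ Q (S₁ ∪ S₂)ᶜ := by
      rw [prob_compl_eq_one_sub₀ (hS₁m.union hS₂m)]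
      have h1 : Q (S₁ ∪ S₂) ≤ ENNReal.ofReal (1 / 2) := by
        refine (measure_union_le _ _).trans ((add_le_add hS₁Q' hS₂Q).trans ?_)
        rw [← ENNReal.ofReal_add (by norm_num) (by norm_num)]
        exact ENNReal.ofReal_le_ofReal (by norm_num)
      refine le_trans ?_ (tsub_le_tsub_left h1 1)
      rw [← ENNReal.ofReal_one, ← ENNReal.ofReal_sub _ (by norm_num)]
      exact ENNReal.ofReal_le_ofReal (by norm_num)
    have h1 := hA.le_measure_of_tilted hint θ
      (hm.mono_ac (absolutelyContinuous_tilted (hA.integrable_exp_upperForm hint θ)))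
      (a := N * (t * s) + a) (fun ω hω => ?_) hc
    · refine le_trans (ENNReal.ofReal_le_ofReal ?_) h1
      refine mul_le_mul_of_nonneg_left (Real.exp_le_exp.2 ?_) (by norm_num)
      rw [hcgf]
      have := mul_le_mul_of_nonneg_right hNle hconv
      linarith
    · have h2 : ω ∉ S₂ := fun h => hω (Or.inr h)
      rw [hS₂, Set.mem_ofPred_eq, not_le, hinner] at h2
      linarith
  · intro ω hω
    refine ⟨blockVec I, orthonormal_blockVec hI hpos, fun v => ?_⟩
    have h1 := norm_toEuclideanLin_le_of_inner_lt _ (hS₁ ω fun h => hω (Or.inl h)) v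
    have h2 := norm_blockMatrix_sub_spectralSum_le hI hpos s v
    simp only [hIl] at h2
    rw [map_sub, LinearMap.sub_apply] at h1
    have h3 : Matrix.toEuclideanLin (A ω) v - spectralSum (blockVec I) (fun j => s * l j) v
        = (Matrix.toEuclideanLin (A ω) v - Matrix.toEuclideanLin M v)
          + (Matrix.toEuclideanLin M v - spectralSum (blockVec I) (fun j => s * l j) v) := by abel
    rw [h3, add_mul]
    exact (norm_add_le _ _).trans (add_le_add h1 h2)

end BlockEvent

/-! ### Consequences of √n ≪ m ≪ n. -/

section Speed

variable {m : ℕ → ℝ}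

theorem speed_tendsto_atTop (hm : Tendsto (fun n : ℕ => m n / Real.sqrt n) atTop atTop) :
    Tendsto m atTop atTop := by
  have h1 : Tendsto (fun n : ℕ => √(n : ℝ)) atTop atTop :=
    Real.tendsto_sqrt_atTop.comp tendsto_natCast_atTop_atTop
  refine (hm.atTop_mul_atTop₀ h1).congr' ?_
  filter_upwards [eventually_gt_atTop 0] with n hn
  have : 0 < √(n : ℝ) := Real.sqrt_pos.2 (by exact_mod_cast hn)
  field_simp

theorem eventually_le_mul_speed_sq (hm : Tendsto (fun n : ℕ => m n / Real.sqrt n) atTop atTop)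
    {δ : ℝ} (hδ : 0 < δ) : ∀ᶠ n : ℕ in atTop, (n : ℝ) ≤ δ * m n ^ 2 := by
  filter_upwards [hm.eventually_ge_atTop (√δ)⁻¹, eventually_gt_atTop 0] with n h1 hn
  have hn' : (0 : ℝ) < n := by exact_mod_cast hn
  have hs : 0 < √δ := Real.sqrt_pos.2 hδ
  rw [le_div_iff₀ (Real.sqrt_pos.2 hn'), inv_mul_le_iff₀ hs] at h1
  calc (n : ℝ) = √(n : ℝ) ^ 2 := (Real.sq_sqrt hn'.le).symm
    _ ≤ (√δ * m n) ^ 2 := pow_le_pow_left₀ (Real.sqrt_nonneg _) h1 2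
    _ = δ * m n ^ 2 := by rw [mul_pow, Real.sq_sqrt hδ.le]

theorem eventually_speed_le_mul (hm : Tendsto (fun n : ℕ => m n / n) atTop (𝓝 0))
    {δ : ℝ} (hδ : 0 < δ) : ∀ᶠ n : ℕ in atTop, m n ≤ δ * n := by
  filter_upwards [hm.eventually (gt_mem_nhds hδ), eventually_gt_atTop 0] with n h1 hn
  have hn' : (0 : ℝ) < n := by exact_mod_cast hn
  rw [div_lt_iff₀ hn'] at h1
  exact h1.le

theorem eventually_exp_neg_speed_le (hm : Tendsto (fun n : ℕ => m n / Real.sqrt n) atTop atTop)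
    {d c : ℝ} (hd : 0 < d) (hc : 0 < c) : ∀ᶠ n : ℕ in atTop, Real.exp (-(d * m n ^ 2)) ≤ c := by
  have h1 : Tendsto (fun n => d * m n ^ 2) atTop atTop :=
    ((tendsto_pow_atTop two_ne_zero).comp (speed_tendsto_atTop hm)).const_mul_atTop hd
  have h2 := (Real.tendsto_exp_neg_atTop_nhds_zero.comp h1).eventually (gt_mem_nhds hc)
  filter_upwards [h2] with n hn using hn.le

theorem eventually_pow_le_exp_speed (hm : Tendsto (fun n : ℕ => m n / Real.sqrt n) atTop atTop)
    {d b : ℝ} (hd : 0 < d) (hb : 1 ≤ b) (k : ℕ) :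
    ∀ᶠ n : ℕ in atTop, b ^ (k * n) ≤ Real.exp (d * m n ^ 2) := by
  have hlog : 0 ≤ Real.log b := Real.log_nonneg hb
  have hD : 0 < k * Real.log b + 1 := by positivity
  filter_upwards [eventually_le_mul_speed_sq hm (div_pos hd hD)] with n hn
  rw [← Real.exp_log (show 0 < b ^ (k * n) by positivity), Real.log_pow]
  refine Real.exp_le_exp.2 ?_
  rw [div_mul_eq_mul_div, le_div_iff₀ hD] at hn
  push_cast
  have : (0 : ℝ) ≤ n := Nat.cast_nonneg n
  linarith

end Speed

/-! ### Asymptotic tail and small ball estimates. -/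

section Asymptotics

variable {k : ℕ} {Ω' : Type*} [MeasurableSpace Ω'] {μ : Measure Ω'} [IsProbabilityMeasure μ]
  {ξ : Ω' → ℝ} {Ω : ℕ → Type*} [∀ n, MeasurableSpace (Ω n)] {P : ∀ n, Measure (Ω n)}
  [∀ n, IsProbabilityMeasure (P n)] {A : ∀ n, Ω n → Matrix (Fin n) (Fin n) ℝ} {m : ℕ → ℝ}
  {C : ℝ}

theorem eventually_measure_leading_le (hf : IsConvexSubquadratic (cgf ξ μ) C)
    (hint : ∀ t, Integrable (fun ω => Real.exp (t * ξ ω)) μ)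
    (hA : ∀ n, IsSymmIIDMatrix (A n) (P n) ξ μ) (hk : 1 ≤ k)
    (hm : Tendsto (fun n : ℕ => m n / Real.sqrt n) atTop atTop)
    {J : ℝ} (hJ : 0 < J) (hJle : (J : EReal) ≤ ⨅ s, legendreRatio (cgf ξ μ) s)
    {r c : ℝ} (hr : 0 ≤ r) (hc : c < J * r ^ 2 / 2) :
    ∀ᶠ n in atTop, ∃ S : Set (Ω n), P n S ≤ ENNReal.ofReal (Real.exp (-(m n ^ 2 * c))) ∧
      ∀ ω ∉ S, ∀ u w : Fin k → EuclideanSpace ℝ (Fin n), (∀ i, ‖u i‖ ≤ 1) → (∀ i, ‖w i‖ ≤ 1) →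
        ‖rankSum u w‖ ≤ 1 → inner ℝ (entryVec (A n ω)) (rankSum u w) < m n * r := by
  -- As ε → 0 the exponent tends to J r²/2 > c. The surplus over c left by a small fixed ε absorbs
  -- the cardinality of the net.
  obtain ⟨ε, hε, hε1, hεc⟩ : ∃ ε : ℝ, 0 < ε ∧ 2 * k * ε ≤ 1 ∧
      c < ((1 - 2 * k * ε) * r) ^ 2 * J / (2 * (1 + 2 * k * ε) ^ 2) := by
    have h1 : ContinuousAt
        (fun ε : ℝ => ((1 - 2 * k * ε) * r) ^ 2 * J / (2 * (1 + 2 * k * ε) ^ 2)) 0 := by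
      refine ContinuousAt.div (by fun_prop) (by fun_prop) (by simp)
    have h2 : ContinuousAt (fun ε : ℝ => 2 * k * ε) 0 := by fun_prop
    have h0 : c < ((1 - 2 * k * 0) * r) ^ 2 * J / (2 * (1 + 2 * k * 0) ^ 2) := by
      have : ((1 - 2 * k * 0) * r) ^ 2 * J / (2 * (1 + 2 * k * 0) ^ 2) = J * r ^ 2 / 2 := by ring
      rwa [this]
    have e1 := h1.tendsto.eventually (lt_mem_nhds h0)
    have h0' : 2 * (k : ℝ) * 0 < 1 := by simp
    have e2 := h2.tendsto.eventually (gt_mem_nhds h0')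
    obtain ⟨ε, h1, h2, h3⟩ := ((e1.filter_mono (nhdsWithin_le_nhds (s := Set.Ioi 0))).and
      ((e2.filter_mono nhdsWithin_le_nhds).and self_mem_nhdsWithin)).exists
    exact ⟨ε, h3, h2.le, h1⟩
  set g := ((1 - 2 * k * ε) * r) ^ 2 * J / (2 * (1 + 2 * k * ε) ^ 2) with hg
  have hb : (1 : ℝ) ≤ 1 + 2 / ε := by
    have : 0 < 2 / ε := by positivity
    linarith
  filter_upwards [eventually_pow_le_exp_speed hm (sub_pos.2 hεc) hb (2 * k),
    (speed_tendsto_atTop hm).eventually_ge_atTop 0] with n hn hmn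
  -- The zero tilt, with the sharp constant 1/(4J) supplied by duality.
  have hX : IsSubgaussianVector (fun ω => entryVec (A n ω)) (P n) (2 * (1 / (4 * J))) := by
    have h := (hA n).isSubgaussianVector_tilted hint 0 (M := 0) Matrix.isHermitian_zero
      (fun _ => rfl) (κ := 1 / (4 * J)) (by positivity) (fun q b => by
        simpa using hf.le_of_le_legendreRatio hJ hJle b)
    have h0 : upperForm (A n) 0 = 0 := by ext ω; simp [upperForm]
    simpa only [h0, tilted_zero, sub_zero] using h
  obtain ⟨S, -, hS, hS'⟩ := hX.exists_exceptional_set (by positivity) hk hε hε1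
    (mul_nonneg hmn hr)
  refine ⟨S, hS.trans (ENNReal.ofReal_le_ofReal ?_), hS'⟩
  have h1 : ((1 - 2 * k * ε) * (m n * r)) ^ 2 / (4 * (2 * (1 / (4 * J))) * (1 + 2 * k * ε) ^ 2)
      = g * m n ^ 2 := by
    rw [hg]; field_simp
  rw [h1]
  refine (mul_le_mul_of_nonneg_right hn (Real.exp_pos _).le).trans ?_
  rw [← Real.exp_add]
  exact Real.exp_le_exp.2 (by linarith)

theorem norm_lt_of_forall_abs_le {x : EuclideanSpace ℝ (Fin k)} {δ : ℝ} (hδ : 0 < δ)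
    (h : ∀ i, |x i| ≤ δ / (k + 1)) : ‖x‖ < δ := by
  have h1 : ‖x‖ ^ 2 ≤ k * (δ / (k + 1)) ^ 2 := by
    rw [EuclideanSpace.real_norm_sq_eq]
    refine (Finset.sum_le_card_nsmul _ _ ((δ / (k + 1)) ^ 2) fun i _ => ?_).trans (by simp)
    rw [← sq_abs]
    exact pow_le_pow_left₀ (abs_nonneg _) (h i) 2
  refine lt_of_pow_lt_pow_left₀ 2 hδ.le (h1.trans_lt ?_)
  rw [div_pow, mul_div_assoc', div_lt_iff₀ (by positivity)]
  have : (0 : ℝ) ≤ k := Nat.cast_nonneg k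
  have : 0 < δ ^ 2 := by positivity
  have : 0 < δ ^ 2 * (k ^ 2 + k + 1) := by positivity
  linarith

theorem tendsto_blockSize_div (hm : Tendsto m atTop atTop) {y : ℝ} (hy : 0 ≤ y) :
    Tendsto (fun n => ((⌊y * m n⌋₊ + 1 : ℕ) : ℝ) / m n) atTop (𝓝 y) := by
  have h1 := (tendsto_nat_floor_mul_div_atTop hy).comp hm
  have h2 := tendsto_inv_atTop_zero.comp hm
  have := h1.add h2
  rw [add_zero] at this
  refine this.congr fun n => ?_
  simp only [Function.comp_apply]
  push_cast
  ring

theorem eventually_le_measure_block (hf : IsConvexSubquadratic (cgf ξ μ) C)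
    (hint : ∀ t, Integrable (fun ω => Real.exp (t * ξ ω)) μ)
    (hA : ∀ n, IsSymmIIDMatrix (A n) (P n) ξ μ)
    (hm : Tendsto (fun n : ℕ => m n / Real.sqrt n) atTop atTop)
    (hm' : Tendsto (fun n : ℕ => m n / n) atTop (𝓝 0)) (t : ℝ) {y : Fin k → ℝ}
    (hy : ∀ j, 0 ≤ y j) {δ η : ℝ} (hδ : 0 < δ) (hη : 0 < η) :
    ∀ᶠ n in atTop, ∃ S : Set (Ω n), ENNReal.ofReal (Real.exp (-(m n ^ 2
        * ((∑ j, y j ^ 2) / 2 * (t * deriv (cgf ξ μ) t - cgf ξ μ t) + η)))) ≤ P n S ∧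
      ∀ ω ∈ S, ∃ e : Fin k → EuclideanSpace ℝ (Fin n), Orthonormal ℝ e ∧
        ∀ v, ‖Matrix.toEuclideanLin (A n ω) v
          - spectralSum e (fun j => deriv (cgf ξ μ) t * (⌊y j * m n⌋₊ + 1 : ℕ)) v‖
          ≤ (δ * m n + |deriv (cgf ξ μ) t|) * ‖v‖ := by
  set g := t * deriv (cgf ξ μ) t - cgf ξ μ t with hg
  have hg0 : 0 ≤ g := by
    have := hf.tangent_le t 0
    rw [hf.map_zero] at this
    linarith
  obtain ⟨κ₁, hκ₁, H₁⟩ := hf.exists_increment_le 0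
  obtain ⟨κ₂, hκ₂, H₂⟩ := hf.exists_increment_le t
  set κ := max κ₁ κ₂
  have hκ : 0 < κ := lt_max_of_lt_left hκ₁
  have hmtop := speed_tendsto_atTop hm
  set Y := (∑ j, y j ^ 2) / 2 with hY
  have hY0 : 0 ≤ Y := by positivity
  set W := ∑ j, y j with hW
  have hW0 : 0 ≤ W := Finset.sum_nonneg fun j _ => hy j
  have hsumlim : Tendsto (fun n => ∑ j, ((⌊y j * m n⌋₊ + 1 : ℕ) : ℝ) / m n) atTop (𝓝 W) :=
    tendsto_finsetSum _ fun j _ => tendsto_blockSize_div hmtop (hy j)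
  have hsqlim : Tendsto (fun n => (∑ j, (((⌊y j * m n⌋₊ + 1 : ℕ) : ℝ) / m n) ^ 2) / 2) atTop
      (𝓝 Y) :=
    (tendsto_finsetSum _ fun j _ => (tendsto_blockSize_div hmtop (hy j)).pow 2).div_const 2
  have hglim := hsqlim.mul_const g
  -- Half of the noise exponent at ρ = δ m: one half beats the net size 9^(2n), the other makes the
  -- probability small.
  set d₁ := δ ^ 2 / (144 * κ) with hd₁
  -- The concentration exponent for fluctuations of size (η/2) m² of the tilting form; the last + 1
  -- keeps the variance proxy positive when t = 0.
  set d₂ := (η / 2) ^ 2 / (8 * κ * (t ^ 2 * (Y + 1) + 1)) with hd₂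
  filter_upwards [hmtop.eventually_gt_atTop 0, hsumlim.eventually (gt_mem_nhds (lt_add_one W)),
    hsqlim.eventually (gt_mem_nhds (lt_add_one Y)),
    hglim.eventually (gt_mem_nhds (lt_add_of_pos_right (Y * g) (by positivity : 0 < η / 4))),
    eventually_speed_le_mul hm' (by positivity : 0 < 1 / (W + 1)),
    eventually_pow_le_exp_speed hm (by positivity : 0 < d₁) (by norm_num : (1 : ℝ) ≤ 9) 2,
    eventually_exp_neg_speed_le hm (by positivity : 0 < d₁) (by norm_num : (0 : ℝ) < 1 / 4),
    eventually_exp_neg_speed_le hm (by positivity : 0 < d₂) (by norm_num : (0 : ℝ) < 1 / 4),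
    eventually_exp_neg_speed_le hm (by positivity : 0 < η / 4) (by norm_num : (0 : ℝ) < 1 / 2)]
    with n hmn h1 h2 h3 h4 h5 h6 h7 h8
  have hsq : (∑ j, (((⌊y j * m n⌋₊ + 1 : ℕ) : ℝ) / m n) ^ 2) / 2
      = ((∑ j, ((⌊y j * m n⌋₊ + 1 : ℕ) : ℝ) ^ 2) / 2) / m n ^ 2 := by
    simp only [div_pow, ← Finset.sum_div]
    ring
  have hmn2 : 0 < m n ^ 2 := by positivity
  rw [hsq] at h2 h3
  rw [div_lt_iff₀ hmn2] at h2
  rw [div_mul_eq_mul_div, div_lt_iff₀ hmn2] at h3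
  have hln : ∑ j, (⌊y j * m n⌋₊ + 1) ≤ n := by
    rw [← Finset.sum_div, div_lt_iff₀ hmn] at h1
    rw [one_div, inv_mul_eq_div, le_div_iff₀ (by positivity)] at h4
    have : ((∑ j, (⌊y j * m n⌋₊ + 1) : ℕ) : ℝ) ≤ n := by
      push_cast at h1 ⊢
      linarith
    exact_mod_cast this
  have hb : t ^ 2 * ((∑ j, ((⌊y j * m n⌋₊ + 1 : ℕ) : ℝ) ^ 2) / 2)
      ≤ (t ^ 2 * (Y + 1) + 1) * m n ^ 2 := by
    have := mul_le_mul_of_nonneg_left h2.le (sq_nonneg t)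
    linarith
  have hB1 : (9 : ℝ) ^ (2 * n) * Real.exp (-((δ * m n) ^ 2 / (72 * κ))) ≤ 1 / 4 := by
    have h10 : -((δ * m n) ^ 2 / (72 * κ)) = -(d₁ * m n ^ 2) + -(d₁ * m n ^ 2) := by
      rw [hd₁]; field_simp; ring
    rw [h10, Real.exp_add, ← mul_assoc]
    refine le_trans ?_ h6
    refine mul_le_of_le_one_left (Real.exp_pos _).le ?_
    refine (mul_le_mul_of_nonneg_right h5 (Real.exp_pos _).le).trans ?_
    rw [← Real.exp_add]
    simp
  have hB2 : Real.exp (-((η / 2 * m n ^ 2) ^ 2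
      / (8 * κ * ((t ^ 2 * (Y + 1) + 1) * m n ^ 2)))) ≤ 1 / 4 := by
    convert h7 using 3
    rw [hd₂]
    field_simp
  obtain ⟨S, hS, hS'⟩ := (hA n).exists_block_event hint (t := t) hκ hf.deriv_zero hg0
    (fun b => (H₁ b).trans (mul_le_mul_of_nonneg_right (le_max_left _ _) (sq_nonneg b)))
    (fun b => (H₂ b).trans (mul_le_mul_of_nonneg_right (le_max_right _ _) (sq_nonneg b)))
    (l := fun j => ⌊y j * m n⌋₊ + 1) (fun j => Nat.succ_pos _) hln
    (ρ := δ * m n) (a := η / 2 * m n ^ 2) (β := (t ^ 2 * (Y + 1) + 1) * m n ^ 2)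
    (by positivity) (by positivity) (by positivity) hb hB1 hB2
  refine ⟨S, le_trans (ENNReal.ofReal_le_ofReal ?_) hS, hS'⟩
  have h9 : Real.exp (-(m n ^ 2 * (Y * g + η))) ≤ Real.exp (-(η / 4 * m n ^ 2))
      * Real.exp (-((∑ j, ((⌊y j * m n⌋₊ + 1 : ℕ) : ℝ) ^ 2) / 2 * g + η / 2 * m n ^ 2)) := by
    rw [← Real.exp_add]
    exact Real.exp_le_exp.2 (by linarith)
  exact h9.trans (mul_le_mul_of_nonneg_right h8 (Real.exp_pos _).le)

/-- Rounding a block size costs at most one row. The + 1 keeps every block nonempty, so that there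
are always k orthonormal block vectors, even where x vanishes. -/
theorem abs_mul_blockSize_sub_le {s x M : ℝ} (hM : 0 ≤ M) (hx : 0 ≤ x) (hs : s = 0 → x = 0) :
    |(|s| * (⌊x / |s| * M⌋₊ + 1 : ℕ)) - M * x| ≤ |s| := by
  rcases eq_or_ne s 0 with h | h
  · simp [h, hs h]
  have hs0 : 0 < |s| := abs_pos.2 h
  have h1 := Nat.floor_le (show 0 ≤ x / |s| * M by positivity)
  have h2 := Nat.lt_floor_add_one (x / |s| * M)
  have h3 : |s| * (x / |s| * M) = M * x := by field_simp
  have h4 := mul_le_mul_of_nonneg_left h1 hs0.le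
  have h5 := mul_le_mul_of_nonneg_left h2.le hs0.le
  push_cast
  rw [abs_le]
  constructor <;> linarith

theorem eventually_le_measure_near (hf : IsConvexSubquadratic (cgf ξ μ) C)
    (hint : ∀ t, Integrable (fun ω => Real.exp (t * ξ ω)) μ)
    (hA : ∀ n, IsSymmIIDMatrix (A n) (P n) ξ μ)
    (hm : Tendsto (fun n : ℕ => m n / Real.sqrt n) atTop atTop)
    (hm' : Tendsto (fun n : ℕ => m n / n) atTop (𝓝 0)) {t : ℝ} {x : EuclideanSpace ℝ (Fin k)}
    (hx : x ∈ orderedCone k) (hxt : deriv (cgf ξ μ) t = 0 → x = 0) {δ η : ℝ}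
    (hδ : 0 < δ) (hη : 0 < η) :
    ∀ᶠ n in atTop, ∃ S : Set (Ω n), ENNReal.ofReal (Real.exp (-(m n ^ 2
        * (‖x‖ ^ 2 / 2 * ((t * deriv (cgf ξ μ) t - cgf ξ μ t) / deriv (cgf ξ μ) t ^ 2) + η))))
          ≤ P n S ∧
      ∀ ω ∈ S, ‖(m n)⁻¹ • topSingularValues k (A n ω) - x‖ < δ ∧
        (0 ≤ deriv (cgf ξ μ) t →
          ‖(m n)⁻¹ • topEigenvalues k ((hA n).isHermitian ω) - x‖ < δ) := by
  set s := deriv (cgf ξ μ) t with hs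
  have hmtop := speed_tendsto_atTop hm
  set δ₁ := δ / (k + 1) with hδ₁
  have hδ₁0 : 0 < δ₁ := by positivity
  -- Two errors of size |s| arise, from the zero diagonal and from rounding; together they must stay
  -- below δ₁ m / 2.
  filter_upwards [hmtop.eventually_gt_atTop 0, hmtop.eventually_ge_atTop (4 * |s| / δ₁),
    eventually_ge_atTop k, eventually_le_measure_block hf hint hA hm hm' t
      (y := fun j => x j / |s|) (fun j => div_nonneg (hx.2 j) (abs_nonneg s))
      (half_pos hδ₁0) hη] with n hmn hmn' hkn ⟨S, hS, hS'⟩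
  have hval : (∑ j, (x j / |s|) ^ 2) / 2 * (t * s - cgf ξ μ t)
      = ‖x‖ ^ 2 / 2 * ((t * s - cgf ξ μ t) / s ^ 2) := by
    simp only [div_pow, sq_abs, ← Finset.sum_div, EuclideanSpace.real_norm_sq_eq]
    ring
  refine ⟨S, by rw [← hval]; exact hS, fun ω hω => ?_⟩
  obtain ⟨e, he, hev⟩ := hS' ω hω
  set l : Fin k → ℕ := fun j => ⌊x j / |s| * m n⌋₊ + 1 with hl
  have hlanti : Antitone l := fun i j hij => by
    refine Nat.add_le_add_right (Nat.floor_le_floor ?_) 1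
    exact mul_le_mul_of_nonneg_right
      (div_le_div_of_nonneg_right (hx.1 i j hij) (abs_nonneg s)) hmn.le
  have hfin : Module.finrank ℝ (EuclideanSpace ℝ (Fin n)) = n := finrank_euclideanSpace_fin
  have hsmall : 2 * |s| ≤ δ₁ / 2 * m n := by
    rw [div_le_iff₀ hδ₁0] at hmn'
    linarith
  have close : ∀ (i : Fin k) (z : ℝ), |z - |s| * l i| ≤ δ₁ / 2 * m n + |s| →
      |(m n)⁻¹ * z - x i| ≤ δ₁ := by
    intro i z hz
    have h1 := abs_mul_blockSize_sub_le (s := s) hmn.le (hx.2 i) fun h => by rw [hxt h]; rfl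
    have h2 : |z - m n * x i| ≤ δ₁ * m n := by
      have := abs_sub_le z (|s| * l i) (m n * x i)
      linarith
    have h3 : (m n)⁻¹ * z - x i = (m n)⁻¹ * (z - m n * x i) := by field_simp
    rw [h3, abs_mul, abs_of_pos (inv_pos.2 hmn), inv_mul_le_iff₀ hmn]
    linarith
  constructor
  · refine norm_lt_of_forall_abs_le hδ fun i => close i _ ?_
    have := he.abs_singularValues_sub_le (Matrix.toEuclideanLin (A n ω))
      (c := fun j => s * l j) (fun i j hij => by
        simp only [abs_mul, Nat.abs_cast]
        exact mul_le_mul_of_nonneg_left (by exact_mod_cast hlanti hij) (abs_nonneg s))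
      (by positivity) hev i (by rw [hfin]; omega)
    rw [abs_mul, Nat.abs_cast] at this
    exact this
  · intro hs0
    refine norm_lt_of_forall_abs_le hδ fun i => close i _ ?_
    have hin : (i : ℕ) < Fintype.card (Fin n) := by rw [Fintype.card_fin]; omega
    have := he.abs_eigenvalues_sub_le
      (Matrix.isSymmetric_toEuclideanLin_iff.mpr ((hA n).isHermitian ω))
      (n := Fintype.card (Fin n)) finrank_euclideanSpace (c := fun j => s * l j)
      (fun i j hij => mul_le_mul_of_nonneg_left (by exact_mod_cast hlanti hij) hs0)
      (fun j => mul_nonneg hs0 (Nat.cast_nonneg _)) hev i hin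
    have heq : topEigenvalues k ((hA n).isHermitian ω) i
        = ((hA n).isHermitian ω).eigenvalues₀ ⟨i, hin⟩ := dif_pos hin
    change |topEigenvalues k ((hA n).isHermitian ω) i - _| ≤ _
    rw [heq, abs_of_nonneg hs0]
    rwa [← hs, abs_of_nonneg hs0] at this

end Asymptotics

/-! ### The rate function and reduction of the LDP to three bounds. -/

section Rate

variable {k : ℕ} {f : ℝ → ℝ}

theorem ldpRate_of_mem {x : EuclideanSpace ℝ (Fin k)} (hx : x ∈ orderedCone k) :
    ldpRate f k x = ((‖x‖ ^ 2 / 2 : ℝ) : EReal) * ⨅ s : ℝ, legendreRatio f s := if_pos hx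

theorem ldpRate_of_notMem {x : EuclideanSpace ℝ (Fin k)} (hx : x ∉ orderedCone k) :
    ldpRate f k x = ⊤ := if_neg hx

theorem isClosed_orderedCone (k : ℕ) : IsClosed (orderedCone k) := by
  have h : orderedCone k = (⋂ (i : Fin k) (j : Fin k) (_ : i ≤ j), {x | x j ≤ x i})
      ∩ ⋂ i : Fin k, {x | 0 ≤ x i} := by
    ext x; simp [orderedCone]
  rw [h]
  refine IsClosed.inter (isClosed_iInter fun i => isClosed_iInter fun j => isClosed_iInter fun _ =>
    isClosed_le (by fun_prop) (by fun_prop)) (isClosed_iInter fun i =>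
    isClosed_le (by fun_prop) (by fun_prop))

theorem zero_mem_orderedCone (k : ℕ) : (0 : EuclideanSpace ℝ (Fin k)) ∈ orderedCone k :=
  ⟨fun _ _ _ => le_rfl, fun _ => le_rfl⟩

theorem ldpRate_zero (f : ℝ → ℝ) (k : ℕ) : ldpRate f k 0 = 0 := by
  rw [ldpRate_of_mem (zero_mem_orderedCone k)]
  simp

theorem le_ldpRate {J : ℝ} (hJ : (J : EReal) ≤ ⨅ s : ℝ, legendreRatio f s)
    (x : EuclideanSpace ℝ (Fin k)) : ((‖x‖ ^ 2 / 2 * J : ℝ) : EReal) ≤ ldpRate f k x := by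
  by_cases hx : x ∈ orderedCone k
  · rw [ldpRate_of_mem hx, EReal.coe_mul]
    exact mul_le_mul_of_nonneg_left hJ (EReal.coe_nonneg.2 (by positivity))
  · rw [ldpRate_of_notMem hx]; exact le_top

theorem ldpRate_eq_top {x : EuclideanSpace ℝ (Fin k)}
    (hJ : ⨅ s : ℝ, legendreRatio f s = ⊤) (hx : x ≠ 0) : ldpRate f k x = ⊤ := by
  by_cases h : x ∈ orderedCone k
  · rw [ldpRate_of_mem h, hJ, EReal.coe_mul_top_of_pos (by positivity)]
  · exact ldpRate_of_notMem h

theorem isGoodRateFunction_ldpRate {J : ℝ} (hJ : 0 < J)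
    (hJle : (J : EReal) ≤ ⨅ s : ℝ, legendreRatio f s) (k : ℕ) :
    IsGoodRateFunction (ldpRate f k) := by
  refine ⟨fun x => le_trans (EReal.coe_nonneg.2 (by positivity)) (le_ldpRate hJle x), fun c => ?_⟩
  -- When the infimum is infinite the rate is finite only at the origin.
  rcases eq_or_ne (⨅ s : ℝ, legendreRatio f s) ⊤ with htop | htop
  · refine (Set.Finite.subset (Set.finite_singleton (0 : EuclideanSpace ℝ (Fin k)))
      fun x hx => ?_).isCompact
    by_contra h0
    have hx : ldpRate f k x ≤ c := hx
    rw [ldpRate_eq_top htop h0] at hx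
    exact EReal.coe_ne_top c (top_le_iff.1 hx)
  · lift (⨅ s : ℝ, legendreRatio f s) to ℝ using
      ⟨htop, fun h => EReal.coe_ne_bot J (le_bot_iff.1 (h ▸ hJle))⟩ with j hj
    have hj0 : 0 < j := hJ.trans_le (EReal.coe_le_coe_iff.1 hJle)
    have hset : {x | ldpRate f k x ≤ c} = orderedCone k ∩ {x | ‖x‖ ^ 2 / 2 * j ≤ c} := by
      ext x
      by_cases hx : x ∈ orderedCone k
      · simp only [Set.mem_ofPred_eq, Set.mem_inter_iff, hx, true_and, ldpRate_of_mem hx, ← hj]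
        exact_mod_cast Iff.rfl
      · simp [hx, ldpRate_of_notMem hx]
    rw [hset]
    refine (isCompact_closedBall (0 : EuclideanSpace ℝ (Fin k)) (2 * |c| / j + 1)).of_isClosed_subset
      ((isClosed_orderedCone k).inter (isClosed_le (by fun_prop) continuous_const)) fun x hx => ?_
    rw [mem_closedBall_zero_iff]
    have h1 : ‖x‖ ^ 2 / 2 * j ≤ c := hx.2
    have h2 : ‖x‖ ^ 2 ≤ 2 * |c| / j := by
      rw [le_div_iff₀ hj0]
      linarith [le_abs_self c]
    nlinarith [norm_nonneg x, sq_nonneg (‖x‖ - 1)]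

/-- The part of a closed set in the cone avoids a ball whose radius is governed by the infimum of
the rate function. -/
theorem exists_radius_of_lt_iInf {J : ℝ} (hJ : 0 < J)
    (hJle : (J : EReal) ≤ ⨅ s : ℝ, legendreRatio f s) {F : Set (EuclideanSpace ℝ (Fin k))}
    (hF : IsClosed F) {c : ℝ} (hc : 0 ≤ c) (h : (c : EReal) < ⨅ x ∈ F, ldpRate f k x) :
    ∃ J' r : ℝ, 0 < J' ∧ (J' : EReal) ≤ ⨅ s : ℝ, legendreRatio f s ∧ 0 ≤ r ∧
      c < J' * r ^ 2 / 2 ∧ ∀ x ∈ F, x ∈ orderedCone k → r < ‖x‖ := by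
  rcases eq_or_ne (⨅ s : ℝ, legendreRatio f s) ⊤ with htop | htop
  · have h0 : (0 : EuclideanSpace ℝ (Fin k)) ∉ F := fun h0 => by
      have h1 := h.trans_le (iInf₂_le 0 h0)
      rw [ldpRate_zero] at h1
      exact absurd (EReal.coe_lt_coe_iff.1 h1) hc.not_gt
    obtain ⟨r, hr, hrF⟩ := Metric.nhds_basis_closedBall.mem_iff.1 (hF.isOpen_compl.mem_nhds h0)
    -- Every real constant is admissible here, so the radius is any one missing F and the constant
    -- is then chosen large.
    refine ⟨2 * (c + 1) / r ^ 2, r, by positivity, by rw [htop]; exact le_top, hr.le, ?_,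
      fun x hx _ => ?_⟩
    · have : 2 * (c + 1) / r ^ 2 * r ^ 2 / 2 = c + 1 := by field_simp
      linarith
    · by_contra! hxr
      exact hrF (mem_closedBall_zero_iff.2 hxr) hx
  · obtain ⟨c', hcc', hc'⟩ := EReal.lt_iff_exists_real_btwn.1 h
    have hcc' : c < c' := EReal.coe_lt_coe_iff.1 hcc'
    lift (⨅ s : ℝ, legendreRatio f s) to ℝ using
      ⟨htop, fun h => EReal.coe_ne_bot J (le_bot_iff.1 (h ▸ hJle))⟩ with j hj
    have hj0 : 0 < j := hJ.trans_le (EReal.coe_le_coe_iff.1 hJle)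
    have hc'0 : 0 ≤ c' := hc.trans hcc'.le
    have hsq : √(2 * c' / j) ^ 2 = 2 * c' / j := Real.sq_sqrt (by positivity)
    refine ⟨j, √(2 * c' / j), hj0, le_rfl, Real.sqrt_nonneg _, ?_, fun x hx hxc => ?_⟩
    · rw [hsq]
      have : j * (2 * c' / j) / 2 = c' := by field_simp
      linarith
    · have h1 := hc'.trans_le (iInf₂_le x hx)
      rw [ldpRate_of_mem hxc, ← hj, ← EReal.coe_mul, EReal.coe_lt_coe_iff] at h1
      refine lt_of_pow_lt_pow_left₀ 2 (norm_nonneg x) ?_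
      rw [hsq, div_lt_iff₀ hj0]
      linarith

theorem limsup_log_le {Ω : ℕ → Type*} [∀ n, MeasurableSpace (Ω n)] {P : ∀ n, Measure (Ω n)}
    {S : ∀ n, Set (Ω n)} {m : ℕ → ℝ} (hm : Tendsto m atTop atTop) {c : ℝ}
    (h : ∀ᶠ n in atTop, P n (S n) ≤ ENNReal.ofReal (Real.exp (-(m n ^ 2 * c)))) :
    limsup (fun n => (((m n ^ 2)⁻¹ : ℝ) : EReal) * ENNReal.log (P n (S n))) atTop
      ≤ ((-c : ℝ) : EReal) := by
  refine limsup_le_of_le (by isBoundedDefault) ?_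
  filter_upwards [h, hm.eventually_gt_atTop 0] with n hn hmn
  have h1 := ENNReal.log_monotone hn
  rw [ENNReal.log_ofReal_of_pos (Real.exp_pos _), Real.log_exp] at h1
  refine (mul_le_mul_of_nonneg_left h1 (EReal.coe_nonneg.2 (by positivity))).trans ?_
  rw [← EReal.coe_mul]
  refine EReal.coe_le_coe_iff.2 (le_of_eq ?_)
  field_simp

theorem le_liminf_log {Ω : ℕ → Type*} [∀ n, MeasurableSpace (Ω n)] {P : ∀ n, Measure (Ω n)}
    {S : ∀ n, Set (Ω n)} {m : ℕ → ℝ} (hm : Tendsto m atTop atTop) {c : ℝ}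
    (h : ∀ᶠ n in atTop, ENNReal.ofReal (Real.exp (-(m n ^ 2 * c))) ≤ P n (S n)) :
    ((-c : ℝ) : EReal)
      ≤ liminf (fun n => (((m n ^ 2)⁻¹ : ℝ) : EReal) * ENNReal.log (P n (S n))) atTop := by
  refine le_liminf_of_le (by isBoundedDefault) ?_
  filter_upwards [h, hm.eventually_gt_atTop 0] with n hn hmn
  have h1 := ENNReal.log_monotone hn
  rw [ENNReal.log_ofReal_of_pos (Real.exp_pos _), Real.log_exp] at h1
  refine le_trans ?_ (mul_le_mul_of_nonneg_left h1 (EReal.coe_nonneg.2 (by positivity)))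
  rw [← EReal.coe_mul]
  refine EReal.coe_le_coe_iff.2 (le_of_eq ?_)
  field_simp

/-- The large deviation principle follows from tail bounds for the norm, asymptotic confinement to
the cone, and lower bounds for the probability of small balls. -/
theorem satisfiesLDP_of_bounds {Ω : ℕ → Type*} [∀ n, MeasurableSpace (Ω n)]
    {P : ∀ n, Measure (Ω n)} [∀ n, IsProbabilityMeasure (P n)] {m : ℕ → ℝ}
    (hm : Tendsto m atTop atTop) {X : ∀ n, Ω n → EuclideanSpace ℝ (Fin k)}
    {J : ℝ} (hJ : 0 < J) (hJle : (J : EReal) ≤ ⨅ s : ℝ, legendreRatio f s)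
    (htail : ∀ J' : ℝ, 0 < J' → (J' : EReal) ≤ ⨅ s : ℝ, legendreRatio f s → ∀ r c : ℝ, 0 ≤ r →
      c < J' * r ^ 2 / 2 →
      ∀ᶠ n in atTop, P n {ω | r ≤ ‖X n ω‖} ≤ ENNReal.ofReal (Real.exp (-(m n ^ 2 * c))))
    (hcone : ∀ F : Set (EuclideanSpace ℝ (Fin k)), IsClosed F → ∀ r : ℝ, 0 ≤ r →
      (∀ x ∈ F, x ∈ orderedCone k → r < ‖x‖) → ∀ᶠ n in atTop, ∀ ω, X n ω ∈ F → r ≤ ‖X n ω‖)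
    (hlow : ∀ x ∈ orderedCone k, ∀ v : ℝ, ldpRate f k x < v → ∀ δ > 0,
      ∀ᶠ n in atTop, ENNReal.ofReal (Real.exp (-(m n ^ 2 * v))) ≤ P n {ω | ‖X n ω - x‖ < δ}) :
    SatisfiesLDP P X (fun n => m n ^ 2) (ldpRate f k) := by
  refine ⟨isGoodRateFunction_ldpRate hJ hJle k, fun F hF => ?_, fun G hG => ?_⟩
  · rw [EReal.le_neg, ← EReal.ge_of_forall_gt_iff_ge]
    intro c hc
    rw [EReal.le_neg]
    -- For c < 0 the trivial bound by 1 suffices; the radius argument requires c ≥ 0.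
    rcases lt_or_ge c 0 with hc0 | hc0
    · refine (limsup_log_le hm (c := 0) (.of_forall fun n => ?_)).trans
        (EReal.coe_le_coe_iff.2 (by linarith))
      simpa using prob_le_one
    · obtain ⟨J', r, hJ', hJ'le, hr, hcr, hFr⟩ := exists_radius_of_lt_iInf hJ hJle hF hc0 hc
      refine limsup_log_le hm ?_
      filter_upwards [htail J' hJ' hJ'le r c hr hcr, hcone F hF r hr hFr] with n h1 h2
      exact (measure_mono fun ω hω => h2 ω hω).trans h1
  · rw [EReal.neg_le]
    refine le_iInf₂ fun x hx => ?_
    rw [← EReal.le_of_forall_lt_iff_le]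
    intro v hv
    have hxc : x ∈ orderedCone k := by
      by_contra h
      rw [ldpRate_of_notMem h] at hv
      exact not_top_lt hv
    obtain ⟨δ, hδ, hδG⟩ := Metric.isOpen_iff.1 hG x hx
    rw [EReal.neg_le]
    refine le_liminf_log hm ?_
    filter_upwards [hlow x hxc v hv δ hδ] with n hn
    refine hn.trans (measure_mono fun ω hω => hδG ?_)
    rw [mem_ball_iff_norm]
    exact hω

end Rate

/-! ### Confinement to the ordered cone. -/

section Cone

variable {k : ℕ}

theorem topSingularValues_mem_orderedCone (k : ℕ) {n : ℕ} (M : Matrix (Fin n) (Fin n) ℝ) :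
    topSingularValues k M ∈ orderedCone k :=
  ⟨fun _ _ hij => LinearMap.singularValues_antitone _ hij,
    fun _ => LinearMap.singularValues_nonneg _ _⟩

theorem smul_mem_orderedCone {x : EuclideanSpace ℝ (Fin k)} (hx : x ∈ orderedCone k) {a : ℝ}
    (ha : 0 ≤ a) : a • x ∈ orderedCone k :=
  ⟨fun i j hij => mul_le_mul_of_nonneg_left (hx.1 i j hij) ha, fun i => mul_nonneg ha (hx.2 i)⟩

theorem topEigenvalues_antitone {n : ℕ} {M : Matrix (Fin n) (Fin n) ℝ} (hM : M.IsHermitian)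
    (hkn : k ≤ n) {i j : Fin k} (hij : i ≤ j) :
    topEigenvalues k hM j ≤ topEigenvalues k hM i := by
  have hlt : ∀ i : Fin k, (i : ℕ) < Fintype.card (Fin n) := fun i => by
    rw [Fintype.card_fin]; omega
  change dite _ _ _ ≤ dite _ _ _
  rw [dif_pos (hlt i), dif_pos (hlt j)]
  exact hM.eigenvalues₀_antitone hij

/-- For a matrix of trace zero the large eigenvalues cannot be very negative. -/
theorem topEigenvalues_ge_of_trace_eq_zero {n : ℕ} {M : Matrix (Fin n) (Fin n) ℝ}
    (hM : M.IsHermitian) (htr : M.trace = 0) (hkn : k ≤ n) (i : Fin k) {R δ : ℝ} (hδ : 0 ≤ δ)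
    (hR : ‖topEigenvalues k hM‖ < R) (h : k * R ≤ (n - k : ℝ) * δ) :
    -δ ≤ topEigenvalues k hM i := by
  have hlt : ∀ i : Fin k, (i : ℕ) < Fintype.card (Fin n) := fun i => by
    rw [Fintype.card_fin]; omega
  have hval : ∀ i, topEigenvalues k hM i = hM.eigenvalues₀ ⟨i, hlt i⟩ := fun i => dif_pos (hlt i)
  have hR0 : 0 ≤ R := (norm_nonneg _).trans hR.le
  by_contra! hlow
  have hneg : topEigenvalues k hM i < 0 := hlow.trans_le (by linarith)
  have htrace : ∑ j, hM.eigenvalues₀ j = 0 := by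
    have h1 := hM.trace_eq_sum_eigenvalues
    rw [htr] at h1
    rw [← (Fintype.equivOfCardEq (Fintype.card_fin (Fintype.card (Fin n)))).symm.sum_comp]
    simpa [Matrix.IsHermitian.eigenvalues] using h1.symm
  -- The first k eigenvalues are at most R and the other n - k at most the i-th one, so zero trace
  -- gives kR + (n - k)λ_i ≥ 0.
  have hkey : ∀ j : Fin (Fintype.card (Fin n)), hM.eigenvalues₀ j
      ≤ if (j : ℕ) < k then R else topEigenvalues k hM i := fun j => by
    split_ifs with hj
    · have h1 := PiLp.norm_apply_le (topEigenvalues k hM) ⟨j, hj⟩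
      rw [hval] at h1
      exact (le_abs_self _).trans (h1.trans hR.le)
    · rw [hval]
      refine hM.eigenvalues₀_antitone ?_
      change (i : ℕ) ≤ j
      omega
  have hsum := Finset.sum_le_sum fun j (_ : j ∈ Finset.univ) => hkey j
  rw [htrace] at hsum
  have hcount : ∑ j : Fin (Fintype.card (Fin n)),
      (if (j : ℕ) < k then R else topEigenvalues k hM i)
      = k * R + (n - k : ℝ) * topEigenvalues k hM i := by
    rw [Fin.sum_univ_eq_sum_range
      (fun j => if j < k then R else topEigenvalues k hM i), Fintype.card_fin,
      ← Finset.sum_range_add_sum_Ico _ hkn]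
    congr 1
    · rw [Finset.sum_congr rfl fun j hj => if_pos (Finset.mem_range.1 hj)]
      simp
    · rw [Finset.sum_congr rfl fun j hj => if_neg (Finset.mem_Ico.1 hj).1.not_gt]
      simp [Nat.cast_sub hkn]
  rw [hcount] at hsum
  have hk1 : (1 : ℝ) ≤ k := by exact_mod_cast Nat.one_le_iff_ne_zero.2 (fun h0 => by
    subst h0; exact i.elim0)
  have hkn' : (0 : ℝ) ≤ n - k := sub_nonneg.2 (by exact_mod_cast hkn)
  have hRpos : 0 < R := (norm_nonneg _).trans_lt hR
  have hpos : (0 : ℝ) < n - k := by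
    by_contra! h'
    have : (n - k : ℝ) = 0 := le_antisymm h' hkn'
    rw [this, zero_mul] at h
    nlinarith
  have := mul_lt_mul_of_pos_left hlow hpos
  linarith

theorem exists_mem_orderedCone_near {x : EuclideanSpace ℝ (Fin k)}
    (hx : ∀ i j : Fin k, i ≤ j → x j ≤ x i) {δ : ℝ} (hδ : 0 < δ)
    (h : ∀ i, -(δ / (k + 1)) ≤ x i) : ∃ y ∈ orderedCone k, ‖x - y‖ < δ := by
  refine ⟨WithLp.toLp 2 fun i => max (x i) 0,
    ⟨fun i j hij => max_le_max (hx i j hij) le_rfl, fun i => le_max_right _ _⟩,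
    norm_lt_of_forall_abs_le hδ fun i => ?_⟩
  have h1 : (x - WithLp.toLp 2 fun i => max (x i) 0 : EuclideanSpace ℝ (Fin k)) i
      = x i - max (x i) 0 := rfl
  have h2 : 0 < δ / (k + 1) := by positivity
  rw [h1, abs_le]
  constructor
  · rcases le_total (x i) 0 with h' | h'
    · rw [max_eq_right h', sub_zero]; exact h i
    · rw [max_eq_left h', sub_self]; linarith
  · linarith [le_max_left (x i) 0]

end Cone

/-! ### The two large deviation principles. -/

theorem mainTheorem3
    {Ω' : Type*} [MeasurableSpace Ω'] (μ : Measure Ω') [IsProbabilityMeasure μ]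
    (ξ : Ω' → ℝ) (hξ : AEMeasurable ξ μ) (hsub : IsSubgaussian ξ μ)
    {Ω : ℕ → Type*} [∀ n, MeasurableSpace (Ω n)]
    (P : ∀ n, Measure (Ω n)) [∀ n, IsProbabilityMeasure (P n)]
    (A : ∀ n, Ω n → Matrix (Fin n) (Fin n) ℝ)
    (hA : ∀ n, IsSymmIIDMatrix (A n) (P n) ξ μ)
    (k : ℕ) (hk : 1 ≤ k) (m : ℕ → ℝ)
    (hm_lower : Tendsto (fun n : ℕ => m n / Real.sqrt n) atTop atTop)
    (hm_upper : Tendsto (fun n : ℕ => m n / n) atTop (𝓝 0)) :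
    SatisfiesLDP P (fun n ω => (m n)⁻¹ • topSingularValues k (A n ω))
        (fun n => m n ^ 2) (ldpRate (cgf ξ μ) k) ∧
    ((∃ s : ℝ, 0 ≤ s ∧ ∀ u : ℝ, legendreRatio (cgf ξ μ) s ≤ legendreRatio (cgf ξ μ) u) →
      SatisfiesLDP P (fun n ω => (m n)⁻¹ • topEigenvalues k ((hA n).isHermitian ω))
        (fun n => m n ^ 2) (ldpRate (cgf ξ μ) k)) := by
  have hint : ∀ t, Integrable (fun ω => Real.exp (t * ξ ω)) μ := fun t => (hsub.choose_spec t).1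
  obtain ⟨C, hf⟩ := hsub.isConvexSubquadratic
  have hmtop := speed_tendsto_atTop hm_lower
  have hJ : 0 < 1 / (4 * C) := by have := hf.pos; positivity
  have htail : ∀ X : ∀ n, Ω n → EuclideanSpace ℝ (Fin k),
      (∀ n ω, ∃ u w : Fin k → EuclideanSpace ℝ (Fin n), (∀ i, ‖u i‖ ≤ 1) ∧ (∀ i, ‖w i‖ ≤ 1) ∧
        ‖rankSum u w‖ ≤ 1 ∧ ‖X n ω‖ ≤ inner ℝ (entryVec (A n ω)) (rankSum u w)) →
      ∀ J' : ℝ, 0 < J' → (J' : EReal) ≤ ⨅ s : ℝ, legendreRatio (cgf ξ μ) s → ∀ r c : ℝ, 0 ≤ r →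
      c < J' * r ^ 2 / 2 → ∀ᶠ n in atTop, P n {ω | r ≤ ‖(m n)⁻¹ • X n ω‖}
        ≤ ENNReal.ofReal (Real.exp (-(m n ^ 2 * c))) := by
    intro X hX J' hJ' hJ'le r c hr hcr
    filter_upwards [eventually_measure_leading_le hf hint hA hk hm_lower hJ' hJ'le hr hcr,
      hmtop.eventually_gt_atTop 0] with n ⟨S, hS, hS'⟩ hmn
    refine (measure_mono fun ω hω => ?_).trans hS
    by_contra hωS
    obtain ⟨u, w, hu, hw, hB, hle⟩ := hX n ω
    have h1 := hle.trans_lt (hS' ω hωS u w hu hw hB)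
    have h2 : r ≤ ‖(m n)⁻¹ • X n ω‖ := hω
    rw [norm_smul, norm_inv, Real.norm_of_nonneg hmn.le, inv_mul_eq_div, le_div_iff₀ hmn] at h2
    linarith
  -- The predicate p is the sign condition on the tilted mean: vacuous for singular values,
  -- nonnegativity for eigenvalues.
  have hlow : ∀ p : ℝ → Prop, p 0 → (∀ r : ℝ, ⨅ s, legendreRatio (cgf ξ μ) s < (r : EReal) →
      ∃ t, deriv (cgf ξ μ) t ≠ 0 ∧ p (deriv (cgf ξ μ) t) ∧
        (t * deriv (cgf ξ μ) t - cgf ξ μ t) / deriv (cgf ξ μ) t ^ 2 < r) →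
      ∀ x ∈ orderedCone k, ∀ v : ℝ, ldpRate (cgf ξ μ) k x < v →
      ∃ t η : ℝ, 0 < η ∧ p (deriv (cgf ξ μ) t) ∧ (deriv (cgf ξ μ) t = 0 → x = 0) ∧
        ‖x‖ ^ 2 / 2 * ((t * deriv (cgf ξ μ) t - cgf ξ μ t) / deriv (cgf ξ μ) t ^ 2) + η ≤ v := by
    intro p hp0 hp x hx v hv
    -- At the origin the rate vanishes even if the infimum is infinite, so no tilt is used there.
    rcases eq_or_ne x 0 with rfl | hx0
    · rw [ldpRate_zero] at hv
      exact ⟨0, v, EReal.coe_pos.1 hv, by rwa [hf.deriv_zero], fun _ => rfl, by simp⟩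
    · have hJtop : ⨅ s, legendreRatio (cgf ξ μ) s ≠ ⊤ := fun h => by
        rw [ldpRate_eq_top h hx0] at hv
        exact not_top_lt hv
      have hx2 : 0 < ‖x‖ ^ 2 / 2 := by positivity
      have hr : ⨅ s, legendreRatio (cgf ξ μ) s < ((v / (‖x‖ ^ 2 / 2) : ℝ) : EReal) := by
        lift (⨅ s : ℝ, legendreRatio (cgf ξ μ) s) to ℝ using ⟨hJtop, fun h =>
          EReal.coe_ne_bot _ (le_bot_iff.1 (h ▸ hf.le_iInf_legendreRatio))⟩ with j hj
        rw [ldpRate_of_mem hx, ← hj, ← EReal.coe_mul, EReal.coe_lt_coe_iff] at hv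
        rw [EReal.coe_lt_coe_iff, lt_div_iff₀ hx2]
        linarith
      obtain ⟨t, ht0, hpt, htr⟩ := hp _ hr
      rw [lt_div_iff₀ hx2] at htr
      exact ⟨t, _, sub_pos.2 htr, hpt, fun h => absurd h ht0, by linarith⟩
  refine ⟨?_, ?_⟩
  · refine satisfiesLDP_of_bounds hmtop hJ hf.le_iInf_legendreRatio
      (htail _ fun n ω => topSingularValues_exists_rankSum_ge k (A n ω)) ?_ ?_
    · intro F _ r _ hFr
      filter_upwards [hmtop.eventually_ge_atTop 0] with n hmn ω hω
      exact (hFr _ hω (smul_mem_orderedCone (topSingularValues_mem_orderedCone k _)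
        (inv_nonneg.2 hmn))).le
    · intro x hx v hv δ hδ
      obtain ⟨t, η, hη, -, hxt, hle⟩ := hlow (fun _ => True) trivial (fun r hr => by
        obtain ⟨t, h1, h2⟩ := hf.exists_deriv_ne_zero hr
        exact ⟨t, h1, trivial, h2⟩) x hx v hv
      filter_upwards [eventually_le_measure_near hf hint hA hm_lower hm_upper hx hxt hδ hη]
        with n ⟨S, hS, hS'⟩
      refine le_trans (ENNReal.ofReal_le_ofReal (Real.exp_le_exp.2 ?_))
        (hS.trans (measure_mono fun ω hω => (hS' ω hω).1))
      exact neg_le_neg (mul_le_mul_of_nonneg_left hle (sq_nonneg _))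
  · rintro ⟨s, hs, hmin⟩
    refine satisfiesLDP_of_bounds hmtop hJ hf.le_iInf_legendreRatio
      (htail _ fun n ω => topEigenvalues_exists_rankSum_ge k ((hA n).isHermitian ω)) ?_ ?_
    · intro F hF r hr hFr
      -- By compactness this part of F lies at positive distance δ from the cone, while zero trace
      -- eventually puts any rescaled eigenvalue vector of norm below r within δ of the cone.
      have hdisj : Disjoint (F ∩ Metric.closedBall 0 r) (orderedCone k) := by
        rw [Set.disjoint_left]
        intro x hx hxc
        exact (hFr x hx.1 hxc).not_ge (mem_closedBall_zero_iff.1 hx.2)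
      obtain ⟨δ, hδ, hδd⟩ := hdisj.exists_thickenings
        ((isCompact_closedBall 0 r).inter_left hF) (isClosed_orderedCone k)
      have hδk : 0 < δ / (k + 1) := by positivity
      have hlarge : ∀ᶠ n : ℕ in atTop, (k * r) / (δ / (k + 1)) + k ≤ (n : ℝ) :=
        tendsto_natCast_atTop_atTop.eventually_ge_atTop _
      filter_upwards [hmtop.eventually_gt_atTop 0, eventually_ge_atTop k, hlarge]
        with n hmn hkn hn ω hω
      by_contra! hlt
      have htr : (A n ω).trace = 0 := by simp [Matrix.trace, (hA n).diag_eq_zero ω]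
      have hnorm : ‖topEigenvalues k ((hA n).isHermitian ω)‖ < m n * r := by
        rw [norm_smul, norm_inv, Real.norm_of_nonneg hmn.le, inv_mul_lt_iff₀ hmn] at hlt
        exact hlt
      have hbound : k * (m n * r) ≤ (n - k : ℝ) * (δ / (k + 1) * m n) := by
        have h1 : (k * r) / (δ / (k + 1)) ≤ n - k := by linarith
        rw [div_le_iff₀ hδk] at h1
        have := mul_le_mul_of_nonneg_right h1 hmn.le
        linarith
      obtain ⟨y, hy, hxy⟩ := exists_mem_orderedCone_near
        (x := (m n)⁻¹ • topEigenvalues k ((hA n).isHermitian ω))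
        (fun i j hij => mul_le_mul_of_nonneg_left
          (topEigenvalues_antitone ((hA n).isHermitian ω) hkn hij) (inv_nonneg.2 hmn.le)) hδ
        (fun i => by
          have h1 := topEigenvalues_ge_of_trace_eq_zero ((hA n).isHermitian ω) htr hkn i
            (δ := δ / (k + 1) * m n) (by positivity) hnorm hbound
          have h2 := mul_le_mul_of_nonneg_left h1 (inv_nonneg.2 hmn.le)
          have h3 : (m n)⁻¹ * -(δ / (k + 1) * m n) = -(δ / (k + 1)) := by field_simp
          rw [h3] at h2
          exact h2)
      refine Set.disjoint_left.1 hδd (Metric.self_subset_thickening hδ _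
        ⟨hω, mem_closedBall_zero_iff.2 hlt.le⟩) (Metric.mem_thickening_iff.2 ⟨y, hy, ?_⟩)
      rwa [dist_eq_norm]
    · intro x hx v hv δ hδ
      obtain ⟨t, η, hη, ht, hxt, hle⟩ := hlow (fun d => 0 ≤ d) le_rfl (fun r hr => by
        obtain ⟨t, h1, h2⟩ := hf.exists_deriv_pos_of_minimizer hs hmin hr
        exact ⟨t, h1.ne', h1.le, h2⟩) x hx v hv
      filter_upwards [eventually_le_measure_near hf hint hA hm_lower hm_upper hx hxt hδ hη]
        with n ⟨S, hS, hS'⟩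
      refine le_trans (ENNReal.ofReal_le_ofReal (Real.exp_le_exp.2 ?_))
        (hS.trans (measure_mono fun ω hω => (hS' ω hω).2 ht))
      exact neg_le_neg (mul_le_mul_of_nonneg_left hle (sq_nonneg _))
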